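/- **Setting.** Let $\mathcal C$ be a cartesian closed category with finite limits (for example a topos), $k$ a commutative ring, and $R$ a commutative $k$-algebra object of $\mathcal C$. A Weil algebra over $k$ is a commutative $k$-algebra of the form $W=k\oplus I$ with $I$ a nilpotent ideal that is free of finite rank over $k$; $\mathrm{Spec}_R W$ denotes the object of $k$-algebra homomorphisms $W\to R$, and the objects isomorphic to some $\mathrm{Spec}_RW$ are called small. Assume the general Kock–Lawvere axiom: for every Weil algebra $W$ the canonical map $R\otimes_k W\to R^{\mathrm{Spec}_R W}$ is an isomorphism. A finite cocone of small objects is a quasi-colimit if $R^{(-)}$ turns it into a limit cone; an object $M$ is microlinear if $M^{(-)}$ turns every quasi-colimit into a limit cone. Mappings $S\to M$ are understood at an arbitrary stage $X\in\mathcal C$, i.e. as morphisms $S\times X\to M$ (for $X=1$: morphisms $S\to M$). For $n\ge 0$ and a set $\mathfrak p$ of pairs of indices let $$D^n\{\mathfrak p\}=\{(d_1,\dots,d_n)\in R^n \mid d_i^2=0 \text{ for all } i,\ d_id_j=0\text{ for all }(i,j)\in\mathfrak p\},\qquad D^n=D^n\{\emptyset\},\quad D=D^1.$$ *Strong differences.*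 For $\gamma_1,\gamma_2:D^{n+2}\to M$, if there is a unique $\mathfrak n:D^{n+3}\{(n+1,n+3),(n+2,n+3)\}\to M$ with $\mathfrak n(d_1,\dots,d_{n+2},d_{n+1}d_{n+2})=\gamma_1(d_1,\dots,d_{n+2})$ and $\mathfrak n(d_1,\dots,d_{n+2},0)=\gamma_2(d_1,\dots,d_{n+2})$, then $\gamma_1\overset{\cdot}{\underset{1\dots n}{-}}\gamma_2:D^{n+1}\to M$ is defined, as the mapping $(d_1,\dots,d_{n+1})\mapsto\mathfrak n(d_1,\dots,d_n,0,0,d_{n+1})$; for $n=0$ it is written $\gamma_1\overset{\cdot}{-}\gamma_2$. For a permutation $\sigma$ of $\{1,\dots,n+2\}$ put $\gamma^\sigma(d_1,\dots,d_{n+2})=\gamma(d_{\sigma^{-1}(1)},\dots,d_{\sigma^{-1}(n+2)})$ and $\gamma_1\overset{\cdot}{\underset{\sigma(1)\dots\sigma(n)}{-}}\gamma_2=\gamma_1^{\sigma}\overset{\cdot}{\underset{1\dots n}{-}}\gamma_2^{\sigma}$. *Sums of tangent vectors.* For $t_1,t_2:D\to M$, if there is a unique $l:D^2\{(1,2)\}\to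 M$ with $l(d,0)=t_1(d)$ and $l(0,d)=t_2(d)$, then $t_1+t_2$ is defined, as the mapping $d\mapsto l(d,d)$. The zero tangent vector at a point $x$ is the constant mapping $d\mapsto x$. **Theorem (four-dimensional general Jacobi identity).** Let $M$ be microlinear. For each of the $24$ permutations of $\{1,2,3,4\}$, written as a word $abcd$, let $\gamma_{abcd}:D^4\to M$ be a mapping. Suppose that whenever two words differ by the interchange of two neighbouring letters $p,q$, the corresponding two mappings have equal restrictions to $D^4\{(p,q)\}$ ($36$ conditions; e.g. $\gamma_{1234}|D^4\{(3,4)\}=\gamma_{1243}|D^4\{(3,4)\}$ and $\gamma_{1234}|D^4\{(2,3)\}=\gamma_{1324}|D^4\{(2,3)\}$). Then, for each of the twelve even permutations $abcd$ of $\{1,2,3,4\}$, the tangent vector $$\Bigl(\bigl(\gamma_{abcd}\overset{\cdot}{\underset{ab}{-}}\gamma_{abdc}\bigr)\overset{\cdot}{\underset{1}{-}}\bigl(\gamma_{acdb}\overset{\cdot}{\underset{ab}{-}}\gamma_{adcb}\bigr)\Bigr)\overset{\cdot}{-}\Bigl(\bigl(\gamma_{bcda}\overset{\cdot}{\underset{ab}{-}}\gamma_{bdca}\bigr)\overset{\cdot}{\underset{1}{-}}\bigl(\gamma_{cdba}\overset{\cdot}{\underset{ab}{-}}\gamma_{dcba}\bigr)\Bigr)$$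 is defined (all the strong differences in it exist; $\underset{ab}{-}$ is formed with the permutation $\sigma=abcd$, so $\sigma(1)=a$, $\sigma(2)=b$), the sum of these twelve tangent vectors, in any order, is defined, and it equals the zero tangent vector at $\gamma_{1234}(0,0,0,0)$. -/

import Mathlib

/-!
Synthetic differential geometry, interpreted in an arbitrary cartesian closed category `C` with
finite limits (for instance any topos) that contains a commutative ring object `R`, the line,
satisfying the general Kock-Lawvere axiom.  A "mapping" between spaces is interpreted at an
arbitrary stage of definition `X`: an element of `M ^ S` at stage `X` is a morphism
`S ⊗ X ⟶ M`, where `⊗` is the cartesian product of `C`.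
-/

universe w v u

open CategoryTheory MonoidalCategory CartesianMonoidalCategory Limits

open scoped CommRingObj TensorProduct

namespace SDG

variable {C : Type u} [Category.{v} C] [CartesianMonoidalCategory C] [BraidedCategory C]

/-- The structure of a `k`-algebra object on a commutative ring object `R`: each ring
`Hom(X, R)` is a `k`-algebra, naturally in `X`. -/
class AlgebraObj (k : Type w) [CommRing k] (R : C) [CommRingObj R] where
  /-- the `k`-algebra structure on the ring of elements of `R` at stage `X` -/
  algebra : ∀ X : C, Algebra k (X ⟶ R)
  comp_algebraMap : ∀ {X Y : C} (f : X ⟶ Y) (a : k),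
    f ≫ (algebra Y).algebraMap a = (algebra X).algebraMap a

instance (k : Type w) [CommRing k] (R : C) [CommRingObj R] [AlgebraObj k R] (X : C) :
    Algebra k (X ⟶ R) :=
  AlgebraObj.algebra X

/-- Change of stage `r ↦ f ≫ r`, as a homomorphism of `k`-algebras. -/
def precomp (k : Type w) [CommRing k] (R : C) [CommRingObj R] [AlgebraObj k R] {X Y : C}
    (f : X ⟶ Y) : (Y ⟶ R) →ₐ[k] (X ⟶ R) where
  toFun r := f ≫ r
  map_one' := MonObj.comp_one f
  map_mul' := MonObj.comp_mul f
  map_zero' := AddMonObj.comp_zero f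
  map_add' := AddMonObj.comp_add f
  commutes' := AlgebraObj.comp_algebraMap f

/-- A Weil algebra over `k`: a commutative `k`-algebra of the form `k ⊕ I`, where the ideal `I`
is nilpotent, and free of finite rank as a `k`-module. -/
def IsWeilAlgebra (k : Type w) [CommRing k] (W : Type w) [CommRing W] [Algebra k W] : Prop :=
  ∃ ε : W →ₐ[k] k, IsNilpotent (RingHom.ker ε) ∧
    Module.Free k (RingHom.ker ε) ∧ Module.Finite k (RingHom.ker ε)

section Small

variable (k : Type w) [CommRing k] (R : C) [CommRingObj R] [AlgebraObj k R]

/-- The object `S`, with the functions `x w : S ⟶ R` for `w ∈ W`, is the space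
`Spec_R W` of `k`-algebra homomorphisms from `W` to `R`.
If `W = k[X₁, …, Xₙ]/I`, this is the subspace of `R ^ n` on which the polynomials in `I` vanish. -/
def IsSpec {W : Type w} [CommRing W] [Algebra k W] {S : C} (x : W →ₐ[k] (S ⟶ R)) : Prop :=
  ∀ (X : C) (φ : W →ₐ[k] (X ⟶ R)), ∃! f : X ⟶ S, (precomp k R f).comp x = φ

/-- Small objects: the objects `Spec_R W`, with `W` a Weil algebra. -/
def IsSmall (S : C) : Prop :=
  ∃ (W : Type w) (_ : CommRing W) (_ : Algebra k W), IsWeilAlgebra k W ∧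
    ∃ x : W →ₐ[k] (S ⟶ R), IsSpec k R x

/-- The general Kock-Lawvere axiom: for every Weil algebra `W`, the canonical map
`R ⊗ W ⟶ R ^ (Spec_R W)` is an isomorphism, i.e. it is bijective on elements at every stage `X`. -/
def KockLawvere : Prop :=
  ∀ (W : Type w) [CommRing W] [Algebra k W], IsWeilAlgebra k W →
    ∀ (S : C) (x : W →ₐ[k] (S ⟶ R)), IsSpec k R x → ∀ X : C,
      Function.Bijective (Algebra.TensorProduct.productMap
        (precomp k R (snd S X)) ((precomp k R (fst S X)).comp x) :
          (X ⟶ R) ⊗[k] W →ₐ[k] (S ⊗ X ⟶ R))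

/-- `M` perceives the cocone `c` as a colimit: the contravariant functor `M ^ (-)` turns `c`
into a limit cone. -/
def Perceives [MonoidalClosed C] (M : C) {J : Type} [SmallCategory J] {F : J ⥤ C}
    (c : Cocone F) : Prop :=
  Nonempty (IsLimit ((MonoidalClosed.internalHom.flip.obj M).mapCone c.op))

/-- `M` is microlinear: it perceives as a colimit every finite cocone of small objects which is a
quasi-colimit, i.e. which the line `R` perceives as a colimit. -/
def Microlinear [MonoidalClosed C] (M : C) : Prop :=
  ∀ (J : Type) [SmallCategory J] [FinCategory J] (F : J ⥤ C) (c : Cocone F),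
    (∀ j, IsSmall k R (F.obj j)) → IsSmall k R c.pt → Perceives R c → Perceives M c

end Small

section Infinitesimal

variable [HasFiniteLimits C] (R : C) [CommRingObj R]

/-- The simplicial small object `D ^ n {p}`: the subobject of `R ^ n` of all `(d₁, …, dₙ)` with
`dᵢ ^ 2 = 0` for all `i` and `dᵢ dⱼ = 0` for all `(i, j) ∈ p`. -/
noncomputable def D (n : ℕ) (p : Finset (Fin n × Fin n)) : C :=
  equalizer
    (Pi.lift fun ij : Fin n × Fin n =>
      if ij.1 = ij.2 ∨ ij ∈ p then
        Pi.π (fun _ : Fin n => R) ij.1 * Pi.π (fun _ : Fin n => R) ij.2 else 0)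
    (Pi.lift fun _ : Fin n × Fin n => (0 : (∏ᶜ fun _ : Fin n => R) ⟶ R))

variable {R} {n : ℕ} {p : Finset (Fin n × Fin n)}

/-- The `i`-th coordinate on `D ^ n {p}`. -/
noncomputable def coord (i : Fin n) : D R n p ⟶ R :=
  equalizer.ι _ _ ≫ Pi.π (fun _ : Fin n => R) i

lemma coord_mul_coord {i j : Fin n} (h : i = j ∨ (i, j) ∈ p) :
    (coord i * coord j : D R n p ⟶ R) = 0 := by
  have := congrArg (· ≫ Pi.π (fun _ : Fin n × Fin n => R) (i, j)) (equalizer.condition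
    (Pi.lift fun ij : Fin n × Fin n =>
      if ij.1 = ij.2 ∨ ij ∈ p then
        Pi.π (fun _ : Fin n => R) ij.1 * Pi.π (fun _ : Fin n => R) ij.2 else 0)
    (Pi.lift fun _ : Fin n × Fin n => (0 : (∏ᶜ fun _ : Fin n => R) ⟶ R)))
  simp only [Category.assoc, limit.lift_π, Fan.mk_π_app, if_pos h, MonObj.comp_mul,
    AddMonObj.comp_zero] at this
  exact this

lemma coord_mul_self (i : Fin n) : (coord i * coord i : D R n p ⟶ R) = 0 :=
  coord_mul_coord (Or.inl rfl)

/-- The element `(a₁, …, aₙ)` of `D ^ n {p}` at stage `Y`. -/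
noncomputable def mk {Y : C} (a : Fin n → (Y ⟶ R)) (ha : ∀ i, a i * a i = 0)
    (hp : ∀ ij ∈ p, a ij.1 * a ij.2 = 0) : Y ⟶ D R n p :=
  equalizer.lift (Pi.lift a) <| by
    refine Pi.hom_ext _ _ fun ij => ?_
    simp only [Category.assoc, limit.lift_π, Fan.mk_π_app, AddMonObj.comp_zero]
    split_ifs with h
    · rw [MonObj.comp_mul]
      simp only [limit.lift_π, Fan.mk_π_app]
      rcases h with h | h
      · rw [h]; exact ha _
      · exact hp _ h
    · exact AddMonObj.comp_zero _

@[simp]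
lemma mk_coord {Y : C} (a : Fin n → (Y ⟶ R)) (ha : ∀ i, a i * a i = 0)
    (hp : ∀ ij ∈ p, a ij.1 * a ij.2 = 0) (i : Fin n) : mk a ha hp ≫ coord i = a i := by
  rw [mk, coord]
  exact (equalizer.lift_ι_assoc _ _ _).trans (by simp)

/-- The canonical injection of `D ^ n {p}` into `D ^ n`. -/
noncomputable def incl (p : Finset (Fin n × Fin n)) : D R n p ⟶ D R n ∅ :=
  mk coord coord_mul_self (by simp)

/-- `(d₁, …, dₙ) ↦ (d_{σ⁻¹(1)}, …, d_{σ⁻¹(n)})`. -/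
noncomputable def permute (σ : Equiv.Perm (Fin n)) : D R n ∅ ⟶ D R n ∅ :=
  mk (fun i => coord (σ⁻¹ i)) (fun _ => coord_mul_self _) (by simp)

/-- The relations `{(n+1, n+3), (n+2, n+3)}`, with indices counted from `0`. -/
def rel (n : ℕ) : Finset (Fin (n + 3) × Fin (n + 3)) :=
  {((Fin.last n).castSucc.castSucc, Fin.last (n + 2)),
    ((Fin.last (n + 1)).castSucc, Fin.last (n + 2))}

/-- `(d₁, …, dₙ₊₂) ↦ (d₁, …, dₙ₊₂, dₙ₊₁ dₙ₊₂)`. -/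
noncomputable def j₁ (n : ℕ) : D R (n + 2) ∅ ⟶ D R (n + 3) (rel n) :=
  mk (Fin.snoc (α := fun _ => D R (n + 2) ∅ ⟶ R) coord
      (coord (Fin.last n).castSucc * coord (Fin.last (n + 1))))
    (by
      intro i
      refine Fin.lastCases ?_ (fun i => ?_) i
      · rw [Fin.snoc_last, mul_mul_mul_comm, coord_mul_self, zero_mul]
      · rw [Fin.snoc_castSucc, coord_mul_self])
    (by
      simp only [rel, Finset.mem_insert, Finset.mem_singleton, forall_eq_or_imp, forall_eq,
        Fin.snoc_last, Fin.snoc_castSucc]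
      exact ⟨by rw [← mul_assoc, coord_mul_self, zero_mul],
        by rw [mul_left_comm, coord_mul_self, mul_zero]⟩)

/-- `(d₁, …, dₙ₊₂) ↦ (d₁, …, dₙ₊₂, 0)`. -/
noncomputable def j₂ (n : ℕ) : D R (n + 2) ∅ ⟶ D R (n + 3) (rel n) :=
  mk (Fin.snoc (α := fun _ => D R (n + 2) ∅ ⟶ R) coord 0)
    (by
      intro i
      refine Fin.lastCases ?_ (fun i => ?_) i
      · rw [Fin.snoc_last, zero_mul]
      · rw [Fin.snoc_castSucc, coord_mul_self])
    (by
      simp only [rel, Finset.mem_insert, Finset.mem_singleton, forall_eq_or_imp, forall_eq,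
        Fin.snoc_last, mul_zero, and_self])

/-- `(d₁, …, dₙ, dₙ₊₁) ↦ (d₁, …, dₙ, 0, 0, dₙ₊₁)`. -/
noncomputable def e (n : ℕ) : D R (n + 1) ∅ ⟶ D R (n + 3) (rel n) :=
  mk (Fin.snoc (α := fun _ => D R (n + 1) ∅ ⟶ R)
      (Fin.snoc (α := fun _ => D R (n + 1) ∅ ⟶ R)
        (Fin.snoc (α := fun _ => D R (n + 1) ∅ ⟶ R) (fun i => coord i.castSucc) 0) 0)
      (coord (Fin.last n)))
    (by
      intro i
      refine Fin.lastCases ?_ (fun i => ?_) i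
      · rw [Fin.snoc_last, coord_mul_self]
      · rw [Fin.snoc_castSucc]
        refine Fin.lastCases ?_ (fun i => ?_) i
        · rw [Fin.snoc_last, zero_mul]
        · rw [Fin.snoc_castSucc]
          refine Fin.lastCases ?_ (fun i => ?_) i
          · rw [Fin.snoc_last, zero_mul]
          · rw [Fin.snoc_castSucc, coord_mul_self])
    (by
      simp only [rel, Finset.mem_insert, Finset.mem_singleton, forall_eq_or_imp, forall_eq,
        Fin.snoc_last, Fin.snoc_castSucc, zero_mul, and_self])

/-- `d ↦ (d, 0)`, from `D` to `D(2) = D ^ 2 {(1, 2)}`. -/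
noncomputable def i₁ : D R 1 ∅ ⟶ D R 2 {(0, 1)} :=
  mk ![coord 0, 0] (by simp [Fin.forall_fin_two, coord_mul_self]) (by simp)

/-- `d ↦ (0, d)`, from `D` to `D(2) = D ^ 2 {(1, 2)}`. -/
noncomputable def i₂ : D R 1 ∅ ⟶ D R 2 {(0, 1)} :=
  mk ![0, coord 0] (by simp [Fin.forall_fin_two, coord_mul_self]) (by simp)

/-- `d ↦ (d, d)`, from `D` to `D(2) = D ^ 2 {(1, 2)}`. -/
noncomputable def diag : D R 1 ∅ ⟶ D R 2 {(0, 1)} :=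
  mk ![coord 0, coord 0] (by simp [Fin.forall_fin_two, coord_mul_self])
    (by simp [coord_mul_self])

end Infinitesimal

section StrongDifference

variable [HasFiniteLimits C]

/-- The mappings `D ^ n → M` (at stage `X`).  For `n = 1` these are the tangent vectors of `M`. -/
abbrev Cube (R : C) [CommRingObj R] (X M : C) (n : ℕ) : Type v := D R n ∅ ⊗ X ⟶ M

variable {R : C} [CommRingObj R] {X M : C}

/-- The restrictions of `γ` and `γ'` to `D ^ n {p}` are equal. -/
def AgreeOn {n : ℕ} (p : Finset (Fin n × Fin n)) (γ γ' : Cube R X M n) : Prop :=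
  incl p ▷ X ≫ γ = incl p ▷ X ≫ γ'

/-- The strong difference `γ₁ ∸_{1…n} γ₂ : D ^ (n+1) → M` of `γ₁, γ₂ : D ^ (n+2) → M`, as a partial
operation.  It is defined when there is a unique mapping `𝔫` on `D ^ (n+3) {(n+1,n+3), (n+2,n+3)}`
with `𝔫 ∘ j₁ = γ₁` and `𝔫 ∘ j₂ = γ₂`, and it is then
`(d₁, …, dₙ₊₁) ↦ 𝔫 (d₁, …, dₙ, 0, 0, dₙ₊₁)`. -/
noncomputable def strongDiff {n : ℕ} (γ₁ γ₂ : Cube R X M (n + 2)) : Part (Cube R X M (n + 1)) where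
  Dom := ∃! 𝔫 : D R (n + 3) (rel n) ⊗ X ⟶ M, j₁ n ▷ X ≫ 𝔫 = γ₁ ∧ j₂ n ▷ X ≫ 𝔫 = γ₂
  get h := e n ▷ X ≫ h.choose

/-- `γ₁ ∸_{σ(1)…σ(n)} γ₂ = γ₁^σ ∸_{1…n} γ₂^σ`, where
`γ^σ (d₁, …, dₙ₊₂) = γ (d_{σ⁻¹(1)}, …, d_{σ⁻¹(n+2)})`. -/
noncomputable def strongDiffPerm {n : ℕ} (σ : Equiv.Perm (Fin (n + 2)))
    (γ₁ γ₂ : Cube R X M (n + 2)) : Part (Cube R X M (n + 1)) :=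
  strongDiff (permute σ ▷ X ≫ γ₁) (permute σ ▷ X ≫ γ₂)

/-- The strong difference of two expressions; it is defined when both expressions are defined
and their values have a strong difference. -/
noncomputable def strongDiffPart {n : ℕ} (a b : Part (Cube R X M (n + 2))) :
    Part (Cube R X M (n + 1)) :=
  a.bind fun γ₁ => b.bind fun γ₂ => strongDiff γ₁ γ₂

/-- The sum of two tangent vectors, as a partial operation: if there is a unique mapping `l` on
`D(2)` with `l (d, 0) = t₁ d` and `l (0, d) = t₂ d`, then `(t₁ + t₂) d = l (d, d)`. -/
noncomputable def tangentAdd (t₁ t₂ : Cube R X M 1) : Part (Cube R X M 1) where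
  Dom := ∃! l : D R 2 {(0, 1)} ⊗ X ⟶ M, i₁ ▷ X ≫ l = t₁ ∧ i₂ ▷ X ≫ l = t₂
  get h := diag ▷ X ≫ h.choose

/-- The value `γ (0, …, 0)`. -/
noncomputable def atZero {n : ℕ} (γ : Cube R X M n) : X ⟶ M :=
  lift (mk (fun _ => 0) (by simp) (by simp)) (𝟙 X) ≫ γ

/-- The zero tangent vector at the point `x` of `M`. -/
noncomputable def tangentZero (R : C) [CommRingObj R] (x : X ⟶ M) : Cube R X M 1 :=
  snd _ _ ≫ x

/-- The sum `t₁ + (t₂ + (… + (tₘ + 0)))` of a list of expressions for tangent vectors at `x`; it is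
defined when all the expressions and all the additions are. -/
noncomputable def tangentSum (x : X ⟶ M) (l : List (Part (Cube R X M 1))) :
    Part (Cube R X M 1) :=
  l.foldr (fun a b => a.bind fun t₁ => b.bind fun t₂ => tangentAdd t₁ t₂)
    (Part.some (tangentZero R x))

/-- The permutation of `{0, 1, 2, 3}` whose word (list of values) is `w`. -/
noncomputable def word (w : Fin 4 → Fin 4) (h : Function.Bijective w := by decide) :
    Equiv.Perm (Fin 4) :=
  Equiv.ofBijective w h

/-- Let `γ` be indexed by the permutations of four letters, a permutation `τ` being read as the word
`abcd = τ(1)τ(2)τ(3)τ(4)`. This is the expression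
`((γ_abcd ∸_ab γ_abdc) ∸_1 (γ_acdb ∸_ab γ_adcb)) ∸ ((γ_bcda ∸_ab γ_bdca) ∸_1 (γ_cdba ∸_ab γ_dcba))`,
where `∸_ab` is formed with the permutation `τ`, which maps `1` to `a` and `2` to `b`. -/
noncomputable def jacobiTerm (γ : Equiv.Perm (Fin 4) → Cube R X M 4) (τ : Equiv.Perm (Fin 4)) :
    Part (Cube R X M 1) :=
  strongDiffPart
    (strongDiffPart
      (strongDiffPerm τ (γ τ) (γ (τ * word ![0, 1, 3, 2])))
      (strongDiffPerm τ (γ (τ * word ![0, 2, 3, 1])) (γ (τ * word ![0, 3, 2, 1]))))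
    (strongDiffPart
      (strongDiffPerm τ (γ (τ * word ![1, 2, 3, 0])) (γ (τ * word ![1, 3, 2, 0])))
      (strongDiffPerm τ (γ (τ * word ![2, 3, 1, 0])) (γ (τ * word ![3, 2, 1, 0]))))

end StrongDifference

end SDG

/-! Compatible families of cubes have a universal example. Functions on `D ^ 4`, one for each word
and subject to the agreement conditions, form the algebra `WordAlg k 3`. Such a family amounts to
free coefficients indexed by classes of pairs (word, squarefree monomial), so the algebra is a Weil
algebra. Its spectrum `G` exists by finite limits (`exists_isSpec`). By the Kock-Lawvere axiom the
24 cubes `D ^ 4 → G` make `G` a quasi-colimit, so microlinearity of `M` gives a single mapping `g`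
out of `G` through which all the given cubes factor (`word_glue`).

Strong differences and sums can then be formed in `G` and carried along `g`
(`exists_push_strongDiff`, `exists_push_tangentAdd`). A mapping into a spectrum is determined by its
composites with the functions `x f`, so only functions with values in `R` have to be computed, and
these are squarefree polynomials. A strong difference subtracts the coefficients of the monomials
that contain both of the last two variables, whose product becomes one new variable; on the
monomials containing neither, it keeps the common coefficient.

Hence every Jacobi term has the common value at the origin as constant coefficient. Its linear
coefficient is `bracket`, a signed sum over eight words of the coefficient of `d₁d₂d₃d₄`. Summed
over the even `τ`, each of the eight contributes the sum over all words of its own parity. The even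
ones carry the signs +, −, +, − and the odd ones −, +, −, +, so everything cancels
(`sum_even_bracket`), and the sum is already the zero tangent vector in `G`. -/

namespace SDG

/-! ### Microlinearity as a gluing property for mappings at every stage. -/

section Gluing

variable {C : Type u} [Category.{v} C] [CartesianMonoidalCategory C] [MonoidalClosed C]

/-- The universal property expressed by `Perceives`, in terms of exponential objects. -/
theorem perceives_iff_ihom (M : C) {J : Type} [SmallCategory J] {F : J ⥤ C} (c : Cocone F) :
    Perceives M c ↔ ∀ (X : C) (t : ∀ j, X ⟶ (ihom (F.obj j)).obj M),
      (∀ {i j : J} (f : i ⟶ j), t j ≫ (MonoidalClosed.pre (F.map f)).app M = t i) →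
        ∃! m : X ⟶ (ihom c.pt).obj M, ∀ j, m ≫ (MonoidalClosed.pre (c.ι.app j)).app M = t j := by
  constructor
  · rintro ⟨h⟩ X t ht
    let s : Cone (F.op ⋙ MonoidalClosed.internalHom.flip.obj M) :=
      { pt := X
        π := { app := fun j => t j.unop
               naturality := fun i j f => (Category.id_comp _).trans (ht f.unop).symm } }
    exact ⟨h.lift s, fun j => h.fac s (Opposite.op j),
      fun m hm => h.uniq s m fun j => hm j.unop⟩
  · intro h
    have key (s : Cone (F.op ⋙ MonoidalClosed.internalHom.flip.obj M)) :=
      h s.pt (fun j => s.π.app (Opposite.op j)) (fun f => s.w f.op)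
    choose m hm hu using key
    exact ⟨{ lift := m
             fac := fun s j => hm s j.unop
             uniq := fun s m' hm' => hu s m' fun j => hm' (Opposite.op j) }⟩

/-- `M` perceives a cocone as a colimit when, at every stage `X`, compatible families of mappings
on the diagram are the restrictions of a unique mapping on the vertex. -/
theorem perceives_iff (M : C) {J : Type} [SmallCategory J] {F : J ⥤ C} (c : Cocone F) :
    Perceives M c ↔ ∀ (X : C) (φ : ∀ j, F.obj j ⊗ X ⟶ M),
      (∀ {i j : J} (f : i ⟶ j), F.map f ▷ X ≫ φ j = φ i) →
        ∃! ψ : c.pt ⊗ X ⟶ M, ∀ j, c.ι.app j ▷ X ≫ ψ = φ j := by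
  rw [perceives_iff_ihom]
  refine forall_congr' fun X => ⟨fun h φ hφ => ?_, fun h t ht => ?_⟩
  · obtain ⟨m, hm, hu⟩ := h (fun j => MonoidalClosed.curry (φ j))
      (fun f => by rw [MonoidalClosed.curry_pre_app, hφ f])
    refine ⟨MonoidalClosed.uncurry m, fun j => ?_, fun ψ hψ => ?_⟩
    · apply MonoidalClosed.curry_injective
      rw [← MonoidalClosed.curry_pre_app, MonoidalClosed.curry_uncurry, hm]
    · rw [← hu (MonoidalClosed.curry ψ) fun j => by rw [MonoidalClosed.curry_pre_app, hψ],
        MonoidalClosed.uncurry_curry]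
  · obtain ⟨ψ, hψ, hu⟩ := h (fun j => MonoidalClosed.uncurry (t j)) (fun f => by
      apply MonoidalClosed.curry_injective
      rw [← MonoidalClosed.curry_pre_app, MonoidalClosed.curry_uncurry, ht,
        MonoidalClosed.curry_uncurry])
    refine ⟨MonoidalClosed.curry ψ, fun j => ?_, fun m hm => ?_⟩
    · rw [MonoidalClosed.curry_pre_app, hψ, MonoidalClosed.curry_uncurry]
    · rw [← hu (MonoidalClosed.uncurry m) fun j => by
        apply MonoidalClosed.curry_injective
        rw [← MonoidalClosed.curry_pre_app, MonoidalClosed.curry_uncurry, hm,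
          MonoidalClosed.curry_uncurry], MonoidalClosed.curry_uncurry]

/-- A cocone over a multispan, perceived as a colimit by `M`. -/
theorem perceives_ofπ_iff (M : C) {J : MultispanShape.{0, 0}} (I : MultispanIndex J C) (G : C)
    (ι : ∀ i, I.right i ⟶ G) (w : ∀ a, I.fst a ≫ ι (J.fst a) = I.snd a ≫ ι (J.snd a)) :
    Perceives M (Multicofork.ofπ I G ι w) ↔ ∀ (X : C) (φ : ∀ i, I.right i ⊗ X ⟶ M),
      (∀ a, I.fst a ▷ X ≫ φ (J.fst a) = I.snd a ▷ X ≫ φ (J.snd a)) →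
        ∃! ψ : G ⊗ X ⟶ M, ∀ i, ι i ▷ X ≫ ψ = φ i := by
  rw [perceives_iff]
  refine forall_congr' fun X => ⟨fun h φ hφ => ?_, fun h φ hφ => ?_⟩
  · obtain ⟨ψ, hψ, hu⟩ := h
      -- The value at a left node is forced by the leg `fst`; the hypothesis says that `snd` forces
      -- the same value.
      (fun j => match j with
        | .left a => I.fst a ▷ X ≫ φ (J.fst a)
        | .right i => φ i) (by
        rintro _ _ (_ | a | a)
        · erw [I.multispan.map_id]
          simp
        · rfl
        · exact (hφ a).symm)
    refine ⟨ψ, fun i => hψ (.right i), fun ψ' hψ' => hu ψ' fun j => ?_⟩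
    rcases j with a | i
    · change (I.fst a ≫ ι _) ▷ X ≫ ψ' = _
      rw [comp_whiskerRight, Category.assoc, hψ']
      rfl
    · exact hψ' i
  · obtain ⟨ψ, hψ, hu⟩ := h (fun i => φ (.right i)) (fun a =>
      (hφ (WalkingMultispan.Hom.fst a)).trans (hφ (WalkingMultispan.Hom.snd a)).symm)
    refine ⟨ψ, fun j => ?_, fun ψ' hψ' => hu ψ' fun i => hψ' (.right i)⟩
    rcases j with a | i
    · change (I.fst a ≫ ι _) ▷ X ≫ ψ = _
      rw [comp_whiskerRight, Category.assoc, hψ]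
      exact hφ (WalkingMultispan.Hom.fst a)
    · exact hψ i

/-- Mappings into a microlinear object can be glued along quasi-colimits of multispans. -/
theorem Microlinear.glue [BraidedCategory C] {k : Type w} [CommRing k] {R : C} [CommRingObj R]
    [AlgebraObj k R] {M : C} (hM : Microlinear k R M) {J : MultispanShape.{0, 0}}
    [Fintype J.L] [Fintype J.R] [DecidableEq J.L] [DecidableEq J.R] (I : MultispanIndex J C) (G : C)
    (ι : ∀ i, I.right i ⟶ G) (w : ∀ a, I.fst a ≫ ι (J.fst a) = I.snd a ≫ ι (J.snd a))
    (hl : ∀ a, IsSmall k R (I.left a)) (hr : ∀ i, IsSmall k R (I.right i)) (hG : IsSmall k R G)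
    (hR : ∀ (X : C) (φ : ∀ i, I.right i ⊗ X ⟶ R),
      (∀ a, I.fst a ▷ X ≫ φ (J.fst a) = I.snd a ▷ X ≫ φ (J.snd a)) →
        ∃! ψ : G ⊗ X ⟶ R, ∀ i, ι i ▷ X ≫ ψ = φ i)
    (X : C) (φ : ∀ i, I.right i ⊗ X ⟶ M)
    (hφ : ∀ a, I.fst a ▷ X ≫ φ (J.fst a) = I.snd a ▷ X ≫ φ (J.snd a)) :
    ∃! ψ : G ⊗ X ⟶ M, ∀ i, ι i ▷ X ≫ ψ = φ i := by
  refine (perceives_ofπ_iff M I G ι w).1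
    (hM _ _ _ ?_ hG ((perceives_ofπ_iff R I G ι w).2 hR)) X φ hφ
  rintro (a | i)
  · exact hl a
  · exact hr i

/-- Mappings into a microlinear object can be glued along quasi-pushouts. -/
theorem Microlinear.glue_pair [BraidedCategory C] {k : Type w} [CommRing k] {R : C} [CommRingObj R]
    [AlgebraObj k R] {M : C} (hM : Microlinear k R M) {S T V : C} {v₁ v₂ : V ⟶ S} {u₁ u₂ : S ⟶ T}
    (w : v₁ ≫ u₁ = v₂ ≫ u₂) (hS : IsSmall k R S) (hT : IsSmall k R T) (hV : IsSmall k R V)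
    (hR : ∀ (X : C) (φ₁ φ₂ : S ⊗ X ⟶ R), v₁ ▷ X ≫ φ₁ = v₂ ▷ X ≫ φ₂ →
      ∃! ψ : T ⊗ X ⟶ R, u₁ ▷ X ≫ ψ = φ₁ ∧ u₂ ▷ X ≫ ψ = φ₂)
    {X : C} (φ₁ φ₂ : S ⊗ X ⟶ M) (hφ : v₁ ▷ X ≫ φ₁ = v₂ ▷ X ≫ φ₂) :
    ∃! ψ : T ⊗ X ⟶ M, u₁ ▷ X ≫ ψ = φ₁ ∧ u₂ ▷ X ≫ ψ = φ₂ := by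
  let J : MultispanShape.{0, 0} := ⟨Unit, Bool, fun _ => true, fun _ => false⟩
  let I : MultispanIndex J C := ⟨fun _ => V, fun _ => S, fun _ => v₁, fun _ => v₂⟩
  have : Fintype J.L := inferInstanceAs (Fintype Unit)
  have : Fintype J.R := inferInstanceAs (Fintype Bool)
  have : DecidableEq J.L := inferInstanceAs (DecidableEq Unit)
  have : DecidableEq J.R := inferInstanceAs (DecidableEq Bool)
  have key := hM.glue I T (fun i => match i with | true => u₁ | false => u₂) (fun _ => w)
    (fun _ => hV) (fun _ => hS) hT (fun X φ hφ => by
      obtain ⟨ψ, hψ, hu⟩ := hR X (φ true) (φ false) (hφ ())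
      refine ⟨ψ, ?_, fun ψ' h => hu ψ' ⟨h true, h false⟩⟩
      rintro (_ | _)
      exacts [hψ.2, hψ.1]) X (fun i => match i with | true => φ₁ | false => φ₂) (fun _ => hφ)
  obtain ⟨ψ, hψ, hu⟩ := key
  refine ⟨ψ, ⟨hψ true, hψ false⟩, fun ψ' h => hu ψ' ?_⟩
  rintro (_ | _)
  exacts [h.2, h.1]

end Gluing

/-! ### The Weil algebra of functions on `D ^ n {p}` and its monomial basis. -/

section WeilAlgebra

/-- A `k`-algebra with finitely many coordinates, one of which is an augmentation whose kernel
consists of nilpotent elements, is a Weil algebra. -/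
theorem isWeilAlgebra_of_coordinates {k : Type w} [CommRing k] {W : Type w} [CommRing W]
    [Algebra k W] {Q : Type*} [Finite Q] (c : W ≃ₗ[k] (Q → k)) (q₀ : Q) (ε : W →ₐ[k] k)
    (hε : ∀ a, ε a = c a q₀) (hn : ∀ a, ε a = 0 → IsNilpotent a) : IsWeilAlgebra k W := by
  classical
  -- The augmentation is the coordinate at `q₀`, so the remaining coordinates parametrize its kernel
  -- freely.
  let c' : RingHom.ker ε ≃ₗ[k] ({q // q ≠ q₀} → k) :=
    { toFun := fun a q => c a.1 q
      map_add' := fun a b => by ext q; simp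
      map_smul' := fun r a => by
        ext q
        change c (r • a.1) q = _
        simp
      invFun := fun f => ⟨c.symm fun q => if h : q ≠ q₀ then f ⟨q, h⟩ else 0, by
        rw [RingHom.mem_ker]
        exact (hε _).trans (by simp)⟩
      left_inv := fun a => by
        apply Subtype.ext
        rw [LinearEquiv.symm_apply_eq]
        ext q
        by_cases h : q = q₀
        · subst h
          have : ε a.1 = 0 := a.2
          simp [← hε, this]
        · simp [h]
      right_inv := fun f => by
        ext q
        simp [q.2] }
  have hfree : Module.Free k (RingHom.ker ε) := Module.Free.of_equiv c'.symm
  have hfin : Module.Finite k (RingHom.ker ε) := Module.Finite.equiv c'.symm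
  refine ⟨ε, ?_, hfree, hfin⟩
  -- Nilpotent elements give a nilpotent ideal only because the kernel is finitely generated.
  have hfin' : Module.Finite W (RingHom.ker ε) := Module.Finite.of_restrictScalars_finite k W _
  rw [Ideal.FG.isNilpotent_iff_le_nilradical (Module.Finite.iff_fg.1 hfin')]
  exact fun a ha => hn a ha

/-- The monomial `∏ xᵢ` over all `i` with `s i = true`. -/
def mon {A : Type*} [CommMonoid A] {n : ℕ} (x : Fin n → A) (s : Fin n → Bool) : A :=
  ∏ i, if s i then x i else 1

lemma map_mon {A B F : Type*} [CommMonoid A] [CommMonoid B] [FunLike F A B] [MonoidHomClass F A B]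
    (f : F) {n : ℕ} (x : Fin n → A) (s : Fin n → Bool) :
    f (mon x s) = mon (fun i => f (x i)) s := by
  simp only [mon, map_prod, apply_ite f, map_one]

lemma mon_eq_zero {A : Type*} [CommMonoidWithZero A] {n : ℕ} {x : Fin n → A} {s : Fin n → Bool}
    {i j : Fin n} (hij : i ≠ j) (hi : s i = true) (hj : s j = true) (h : x i * x j = 0) :
    mon x s = 0 := by
  rw [mon, ← Finset.mul_prod_erase _ _ (Finset.mem_univ i),
    ← Finset.mul_prod_erase _ _ (Finset.mem_erase.2 ⟨hij.symm, Finset.mem_univ j⟩), ← mul_assoc,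
    if_pos hi, if_pos hj, h, zero_mul]

/-- The squarefree monomial with support `s` does not vanish on `D ^ n {p}`. -/
def Indep {n : ℕ} (p : Finset (Fin n × Fin n)) (s : Fin n → Bool) : Prop :=
  ∀ ij ∈ p, ij.1 ≠ ij.2 → ¬(s ij.1 = true ∧ s ij.2 = true)

/-- The exponent of a squarefree monomial. -/
noncomputable def expo {n : ℕ} (s : Fin n → Bool) : Fin n →₀ ℕ :=
  Finsupp.equivFunOnFinite.symm fun i => (s i).toNat

lemma expo_apply {n : ℕ} (s : Fin n → Bool) (i : Fin n) : expo s i = (s i).toNat := rfl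

lemma expo_injective {n : ℕ} : Function.Injective (expo (n := n)) := by
  intro s t h
  ext i
  have := DFunLike.congr_fun h i
  rw [expo_apply, expo_apply] at this
  revert this
  cases s i <;> cases t i <;> simp

variable (k : Type w) [CommRing k] {n : ℕ} (p : Finset (Fin n × Fin n))

/-- The ideal of all polynomials all of whose monomials vanish on `D ^ n {p}`. -/
def vanishing : Ideal (MvPolynomial (Fin n) k) where
  carrier := {f | ∀ s, Indep p s → MvPolynomial.coeff (expo s) f = 0}
  add_mem' hf hg s hs := by rw [MvPolynomial.coeff_add, hf s hs, hg s hs, add_zero]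
  zero_mem' s _ := MvPolynomial.coeff_zero _
  smul_mem' g f hf s hs := by
    classical
    rw [smul_eq_mul, MvPolynomial.coeff_mul]
    refine Finset.sum_eq_zero fun ab hab => ?_
    have hab' : ab.1 + ab.2 = expo s := by simpa using hab
    have hle (i) : ab.1 i + ab.2 i = (s i).toNat := DFunLike.congr_fun hab' i
    -- A factor of a squarefree monomial is squarefree with smaller support, and a subset of an
    -- independent support is independent.
    have hb : ab.2 = expo fun i => decide (ab.2 i = 1) := by
      ext i
      have := hle i
      have := Bool.toNat_le (s i)
      rw [expo_apply]
      by_cases h : ab.2 i = 1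
      · simp [h]
      · simp [h]; omega
    rw [hb, hf _ ?_, mul_zero]
    rintro ij hij hne ⟨h1, h2⟩
    refine hs ij hij hne ?_
    have e1 := hle ij.1
    have e2 := hle ij.2
    simp only [decide_eq_true_eq] at h1 h2
    rw [h1] at e1
    rw [h2] at e2
    constructor
    · revert e1; cases s ij.1 <;> simp
    · revert e2; cases s ij.2 <;> simp

variable {k p}

lemma mem_vanishing {f : MvPolynomial (Fin n) k} :
    f ∈ vanishing k p ↔ ∀ s, Indep p s → MvPolynomial.coeff (expo s) f = 0 := Iff.rfl

/-- Each term dies for one of three reasons: some exponent is at least 2, the support contains a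
forbidden pair, or the monomial is one of those whose coefficient in `f` is zero. -/
lemma aeval_eq_zero_of_mem_vanishing {A : Type*} [CommRing A] [Algebra k A] {x : Fin n → A}
    (hx : ∀ i, x i * x i = 0) (hp : ∀ ij ∈ p, x ij.1 * x ij.2 = 0)
    {f : MvPolynomial (Fin n) k} (hf : f ∈ vanishing k p) : MvPolynomial.aeval x f = 0 := by
  rw [MvPolynomial.aeval_def, MvPolynomial.eval₂_eq]
  refine Finset.sum_eq_zero fun m _ => ?_
  by_cases h2 : ∃ i, 2 ≤ m i
  · obtain ⟨i, hi⟩ := h2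
    rw [Finset.prod_eq_zero (i := i), mul_zero]
    · rw [Finsupp.mem_support_iff]; omega
    · obtain ⟨r, hr⟩ := Nat.exists_eq_add_of_le hi
      rw [hr, pow_add, pow_two, hx, zero_mul]
  · push Not at h2
    have hm : m = expo fun i => decide (m i = 1) := by
      ext i
      have := h2 i
      rw [expo_apply]
      by_cases h : m i = 1
      · simp [h]
      · simp [h]; omega
    by_cases hi : Indep p fun i => decide (m i = 1)
    · rw [hm, hf _ hi, map_zero, zero_mul]
    · simp only [Indep, not_forall, not_not, decide_eq_true_eq] at hi
      obtain ⟨ij, hij, hne, h1, h2⟩ := hi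
      rw [← Finset.mul_prod_erase (a := ij.1), ← Finset.mul_prod_erase (a := ij.2), h1, h2,
        pow_one, pow_one, ← mul_assoc (x ij.1), hp ij hij, zero_mul, mul_zero]
      · simp [h2, hne.symm]
      · simp [h1]

variable (k p)

/-- The Weil algebra of functions on `D ^ n {p}`. -/
abbrev FunAlg : Type w := MvPolynomial (Fin n) k ⧸ vanishing k p

/-- The coefficients of an element of the Weil algebra. -/
noncomputable def FunAlg.coeffs : FunAlg k p →ₗ[k] ({s // Indep p s} → k) :=
  (((vanishing k p).restrictScalars k).liftQ
      (LinearMap.pi fun s => MvPolynomial.lcoeff k (expo s.1))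
      (fun f hf => by
        ext s
        exact hf s.1 s.2)).comp
    (Submodule.Quotient.restrictScalarsEquiv k (vanishing k p)).symm.toLinearMap

lemma FunAlg.coeffs_mk (f : MvPolynomial (Fin n) k) (s : {s // Indep p s}) :
    FunAlg.coeffs k p (Ideal.Quotient.mk _ f) s = MvPolynomial.coeff (expo s.1) f := rfl

/-- The ideal is cut out by exactly these coefficients, which gives injectivity; the independent
squarefree monomials realize all values. -/
lemma FunAlg.coeffs_bijective : Function.Bijective (FunAlg.coeffs k p) := by
  classical
  constructor
  · rw [injective_iff_map_eq_zero]
    intro a ha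
    obtain ⟨f, rfl⟩ := Ideal.Quotient.mk_surjective a
    rw [Ideal.Quotient.eq_zero_iff_mem]
    exact fun s hs => congrFun ha ⟨s, hs⟩
  · intro a
    refine ⟨Ideal.Quotient.mk _ (∑ s, MvPolynomial.monomial (expo s.1) (a s)), ?_⟩
    ext t
    rw [FunAlg.coeffs_mk, MvPolynomial.coeff_sum, Finset.sum_eq_single t]
    · simp
    · intro s _ hs
      rw [MvPolynomial.coeff_monomial, if_neg]
      exact fun h => hs (Subtype.ext (expo_injective h))
    · simp

/-- The Weil algebra of functions on `D ^ n {p}` is free on the monomials which do not vanish. -/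
noncomputable def FunAlg.coeffEquiv : FunAlg k p ≃ₗ[k] ({s // Indep p s} → k) :=
  LinearEquiv.ofBijective _ (FunAlg.coeffs_bijective k p)

lemma FunAlg.coeffEquiv_mk (f : MvPolynomial (Fin n) k) (s : {s // Indep p s}) :
    FunAlg.coeffEquiv k p (Ideal.Quotient.mk _ f) s = MvPolynomial.coeff (expo s.1) f := rfl

/-- The coordinate functions. -/
noncomputable def FunAlg.X (i : Fin n) : FunAlg k p := Ideal.Quotient.mk _ (MvPolynomial.X i)

lemma mon_X (s : Fin n → Bool) :
    mon (MvPolynomial.X (R := k)) s = MvPolynomial.monomial (expo s) 1 := by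
  rw [MvPolynomial.monomial_eq, Finsupp.prod_fintype _ _ (by simp), mon, map_one, one_mul]
  refine Finset.prod_congr rfl fun i _ => ?_
  rw [expo_apply]
  cases s i <;> simp

lemma FunAlg.coeffEquiv_symm_single [DecidableEq {s // Indep p s}] (s : {s // Indep p s}) :
    (FunAlg.coeffEquiv k p).symm (Pi.single s 1) = mon (FunAlg.X k p) s.1 := by
  rw [LinearEquiv.symm_apply_eq]
  have : mon (FunAlg.X k p) s.1 = Ideal.Quotient.mk _ (MvPolynomial.monomial (expo s.1) 1) := by
    rw [← mon_X, map_mon]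
    rfl
  ext t
  rw [this, FunAlg.coeffEquiv_mk, MvPolynomial.coeff_monomial, Pi.single_apply]
  simp only [expo_injective.eq_iff, eq_comm (a := t), Subtype.ext_iff]

/-- A point of `D ^ n {p}` with coordinates in a `k`-algebra. -/
noncomputable def FunAlg.eval {A : Type*} [CommRing A] [Algebra k A] (x : Fin n → A)
    (hx : ∀ i, x i * x i = 0) (hp : ∀ ij ∈ p, x ij.1 * x ij.2 = 0) : FunAlg k p →ₐ[k] A :=
  Ideal.Quotient.liftₐ _ (MvPolynomial.aeval x) fun _ hf =>
    aeval_eq_zero_of_mem_vanishing hx hp hf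

@[simp]
lemma FunAlg.eval_X {A : Type*} [CommRing A] [Algebra k A] (x : Fin n → A)
    (hx : ∀ i, x i * x i = 0) (hp : ∀ ij ∈ p, x ij.1 * x ij.2 = 0) (i : Fin n) :
    FunAlg.eval k p x hx hp (FunAlg.X k p i) = x i :=
  MvPolynomial.aeval_X x i

lemma FunAlg.algHom_ext {A : Type*} [CommRing A] [Algebra k A] {f g : FunAlg k p →ₐ[k] A}
    (h : ∀ i, f (FunAlg.X k p i) = g (FunAlg.X k p i)) : f = g :=
  Ideal.Quotient.algHom_ext _ (MvPolynomial.algHom_ext h)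

lemma FunAlg.X_mul_X {i j : Fin n} (h : i = j ∨ (i, j) ∈ p) :
    FunAlg.X k p i * FunAlg.X k p j = 0 := by
  classical
  rw [FunAlg.X, FunAlg.X, ← map_mul, Ideal.Quotient.eq_zero_iff_mem]
  intro s hs
  rw [MvPolynomial.X, MvPolynomial.X, MvPolynomial.monomial_mul, MvPolynomial.coeff_monomial,
    if_neg]
  intro he
  have hi := DFunLike.congr_fun he i
  have hj := DFunLike.congr_fun he j
  simp only [Finsupp.add_apply, expo_apply, Finsupp.single_apply] at hi hj
  by_cases hij : i = j
  · have := Bool.toNat_le (s i)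
    simp [hij] at hi
    subst hij
    omega
  · refine hs (i, j) (by tauto) hij ?_
    simp [hij, Ne.symm hij] at hi hj
    revert hi hj
    cases s i <;> cases s j <;> simp

/-- The square of a nonconstant monomial has an exponent at least 2, so it is zero here; a sum of
nilpotents is nilpotent. -/
lemma FunAlg.isNilpotent (a : FunAlg k p)
    (ha : FunAlg.coeffEquiv k p a ⟨fun _ => false, fun _ _ _ h => by simp at h⟩ = 0) :
    IsNilpotent a := by
  classical
  obtain ⟨f, rfl⟩ := Ideal.Quotient.mk_surjective a
  rw [FunAlg.coeffEquiv_mk] at ha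
  rw [f.as_sum, map_sum, ← mem_nilradical]
  refine Ideal.sum_mem _ fun m _ => ?_
  rw [mem_nilradical]
  by_cases hm : m = 0
  · have : expo (fun _ : Fin n => false) = 0 := by ext i; rfl
    rw [hm, ← this, ha]
    simp
  · obtain ⟨i, hi⟩ : ∃ i, m i ≠ 0 := by
      by_contra h
      push Not at h
      exact hm (Finsupp.ext h)
    refine ⟨2, ?_⟩
    rw [← map_pow, Ideal.Quotient.eq_zero_iff_mem]
    intro s _
    rw [MvPolynomial.monomial_pow, MvPolynomial.coeff_monomial, if_neg]
    intro he
    have := DFunLike.congr_fun he i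
    have h2 := Bool.toNat_le (s i)
    simp only [Finsupp.smul_apply, smul_eq_mul, expo_apply] at this
    omega

/-- The value at the origin. -/
noncomputable def FunAlg.eps : FunAlg k p →ₐ[k] k :=
  FunAlg.eval k p 0 (by simp) (by simp)

lemma FunAlg.eps_apply (a : FunAlg k p) :
    FunAlg.eps k p a =
      FunAlg.coeffEquiv k p a ⟨fun _ => false, fun _ _ _ h => by simp at h⟩ := by
  obtain ⟨f, rfl⟩ := Ideal.Quotient.mk_surjective a
  rw [FunAlg.coeffEquiv_mk]
  have : expo (fun _ : Fin n => false) = 0 := by ext i; rfl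
  rw [this]
  change MvPolynomial.aeval 0 f = _
  rw [MvPolynomial.aeval_zero]
  rfl

theorem FunAlg.isWeilAlgebra : IsWeilAlgebra k (FunAlg k p) := by
  classical
  exact isWeilAlgebra_of_coordinates (FunAlg.coeffEquiv k p) _ (FunAlg.eps k p)
    (FunAlg.eps_apply k p) fun a ha => FunAlg.isNilpotent k p a (by rw [← ha, FunAlg.eps_apply])

end WeilAlgebra

/-! ### Unique polynomial expansions of functions on `D ^ n {p}`. -/

section Expansion

variable {C : Type u} [Category.{v} C] [CartesianMonoidalCategory C] [BraidedCategory C]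
  {k : Type w} [CommRing k] {R : C} [CommRingObj R] [AlgebraObj k R]

lemma precomp_apply {X Y : C} (f : X ⟶ Y) (r : Y ⟶ R) : precomp k R f r = f ≫ r := rfl

/-- By the Kock-Lawvere axiom, functions on `Spec_R W` have unique expansions in terms of
coordinates on `W`. -/
theorem KockLawvere.bijective (hR : KockLawvere k R) {W : Type w} [CommRing W] [Algebra k W]
    (hW : IsWeilAlgebra k W) {S : C} {x : W →ₐ[k] (S ⟶ R)} (hx : IsSpec k R x)
    {Q : Type*} [Fintype Q] [DecidableEq Q] (c : W ≃ₗ[k] (Q → k)) (X : C) :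
    Function.Bijective fun a : Q → (X ⟶ R) =>
      ∑ q, (snd S X ≫ a q) * (fst S X ≫ x (c.symm (Pi.single q 1))) := by
  let b : Module.Basis Q k W := Module.Basis.ofEquivFun c
  -- Coefficients at stage `X` are coordinates in the base-changed basis, which reduces the claim to
  -- the Kock-Lawvere bijection.
  let b' : Module.Basis Q (X ⟶ R) ((X ⟶ R) ⊗[k] W) := b.baseChange (X ⟶ R)
  have := (hR W hW S x hx X).comp b'.equivFun.symm.bijective
  convert this using 1
  ext1 a
  simp only [Function.comp, Module.Basis.equivFun_symm_apply, map_sum]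
  refine Finset.sum_congr rfl fun q _ => ?_
  rw [Module.Basis.baseChange_apply, TensorProduct.smul_tmul', smul_eq_mul, mul_one,
    Algebra.TensorProduct.productMap_apply_tmul]
  simp only [b, Module.Basis.coe_ofEquivFun]
  rfl

variable [HasFiniteLimits C] {n : ℕ} {p : Finset (Fin n × Fin n)}

lemma D_hom_ext {Y : C} {f g : Y ⟶ D R n p}
    (h : ∀ i, f ≫ coord i = g ≫ coord i) : f = g := by
  refine equalizer.hom_ext (Pi.hom_ext _ _ fun i => ?_)
  exact (Category.assoc _ _ _).trans ((h i).trans (Category.assoc _ _ _).symm)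

variable (k) in
/-- The functions on `D ^ n {p}` given by elements of the Weil algebra. -/
noncomputable def FunAlg.toHom : FunAlg k p →ₐ[k] (D R n p ⟶ R) :=
  FunAlg.eval k p coord coord_mul_self fun _ h => coord_mul_coord (Or.inr h)

lemma FunAlg.toHom_X (i : Fin n) :
    FunAlg.toHom k (FunAlg.X k p i) = (coord i : D R n p ⟶ R) := FunAlg.eval_X _ _ _ _ _ _

theorem FunAlg.isSpec : IsSpec k R (FunAlg.toHom k (R := R) (p := p)) := by
  intro X φ
  refine ⟨mk (fun i => φ (FunAlg.X k p i))
    (fun i => by rw [← map_mul, FunAlg.X_mul_X k p (Or.inl rfl), map_zero])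
    (fun ij h => by rw [← map_mul, FunAlg.X_mul_X k p (Or.inr h), map_zero]), ?_, ?_⟩
  · refine FunAlg.algHom_ext k p fun i => ?_
    rw [AlgHom.comp_apply, FunAlg.toHom_X, precomp_apply, mk_coord]
  · rintro f rfl
    refine D_hom_ext fun i => ?_
    rw [mk_coord, AlgHom.comp_apply, FunAlg.toHom_X, precomp_apply]

variable (k R p) in
theorem isSmall_D : IsSmall k R (D R n p) :=
  ⟨FunAlg k p, _, _, FunAlg.isWeilAlgebra k p, _, FunAlg.isSpec⟩

/-- The function `∑ aₛ xₛ` on `D ^ n {p}`, where `xₛ` is the squarefree monomial with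
support `s`. -/
noncomputable def expand (p : Finset (Fin n × Fin n)) {X : C} (a : (Fin n → Bool) → (X ⟶ R)) :
    D R n p ⊗ X ⟶ R :=
  ∑ s, (snd _ X ≫ a s) * mon (fun i => fst _ X ≫ coord i) s

lemma expand_eq_sum_indep [Fintype {s // Indep p s}] {X : C} (a : (Fin n → Bool) → (X ⟶ R)) :
    expand p a =
      ∑ s : {s // Indep p s}, (snd _ X ≫ a s) * mon (fun i => fst _ X ≫ coord i) s.1 := by
  classical
  rw [expand, ← Finset.sum_subtype (Finset.univ.filter (Indep p)) (by simp)
    (fun s => (snd _ X ≫ a s) * mon (fun i => fst _ X ≫ coord i) s), Finset.sum_filter_of_ne]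
  intro s _ hs
  by_contra hi
  simp only [Indep, not_forall, not_not] at hi
  obtain ⟨ij, hij, hne, h1, h2⟩ := hi
  refine hs ?_
  rw [mon_eq_zero hne h1 h2, mul_zero]
  rw [← MonObj.comp_mul, coord_mul_coord (Or.inr hij), AddMonObj.comp_zero]

/-- This is the Kock-Lawvere axiom read in the monomial basis of `FunAlg k p`. -/
lemma expand_bijective (hR : KockLawvere k R) [Fintype {s // Indep p s}] (X : C) :
    Function.Bijective fun a : {s // Indep p s} → (X ⟶ R) =>
      ∑ s, (snd (D R n p) X ≫ a s) * mon (fun i => fst _ X ≫ coord i) s.1 := by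
  classical
  convert hR.bijective (FunAlg.isWeilAlgebra k p) FunAlg.isSpec (FunAlg.coeffEquiv k p) X using 4
    with a s
  rw [FunAlg.coeffEquiv_symm_single, ← precomp_apply (k := k), map_mon, map_mon]
  simp only [FunAlg.toHom_X]
  rfl

theorem exists_expand (hR : KockLawvere k R) {X : C} (φ : D R n p ⊗ X ⟶ R) :
    ∃ a, expand p a = φ := by
  classical
  obtain ⟨a, ha⟩ := (expand_bijective hR X).2 φ
  -- The default 0 is arbitrary, since dependent monomials vanish on `D ^ n {p}`.
  refine ⟨fun s => if h : Indep p s then a ⟨s, h⟩ else 0, ?_⟩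
  rw [expand_eq_sum_indep, ← ha]
  refine Finset.sum_congr rfl fun s _ => ?_
  rw [dif_pos s.2]

theorem expand_eq_iff (hR : KockLawvere k R) {X : C} {a b : (Fin n → Bool) → (X ⟶ R)} :
    expand p a = expand p b ↔ ∀ s, Indep p s → a s = b s := by
  classical
  rw [expand_eq_sum_indep, expand_eq_sum_indep]
  refine ⟨fun h s hs => ?_, fun h => ?_⟩
  · exact congrFun ((expand_bijective hR X).1 (a₁ := fun s => a s.1) (a₂ := fun s => b s.1) h)
      ⟨s, hs⟩
  · exact Finset.sum_congr rfl fun s _ => by rw [h s.1 s.2]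

end Expansion

/-! ### Substitution of `j₁`, `j₂` and `e` into squarefree polynomials. -/

section Monomials

/-- Append a value to a tuple of truth values. -/
abbrev sn {n : ℕ} (s : Fin n → Bool) (b : Bool) : Fin (n + 1) → Bool :=
  Fin.snoc (α := fun _ => Bool) s b

lemma exists_sn {n : ℕ} (s : Fin (n + 1) → Bool) : ∃ t b, s = sn t b :=
  ⟨fun i => s i.castSucc, s (Fin.last n), (Fin.snoc_init_self s).symm⟩

lemma sum_sn {A : Type*} [AddCommMonoid A] {n : ℕ} (f : (Fin (n + 1) → Bool) → A) :
    ∑ s, f s = ∑ s, (f (sn s false) + f (sn s true)) := by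
  rw [← (Fin.snocEquiv fun _ : Fin (n + 1) => Bool).sum_comp f, Fintype.sum_prod_type_right]
  refine Finset.sum_congr rfl fun s _ => ?_
  rw [Fintype.sum_bool, add_comm]
  rfl

lemma mon_sn {A : Type*} [CommMonoid A] {n : ℕ} (x : Fin (n + 1) → A) (s : Fin n → Bool)
    (b : Bool) :
    mon x (sn s b) = mon (fun i => x i.castSucc) s * if b then x (Fin.last n) else 1 := by
  simp only [mon, Fin.prod_univ_castSucc, Fin.snoc_castSucc, Fin.snoc_last]

lemma mon_zero {A : Type*} [CommMonoid A] (x : Fin 0 → A) (s : Fin 0 → Bool) : mon x s = 1 := by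
  simp [mon]

variable {A : Type*} [CommRing A] {n : ℕ}

/-- The coefficients of `f (d₁, …, dₙ₊₂, dₙ₊₁ dₙ₊₂)`. -/
def j₁Coeff (c : (Fin (n + 3) → Bool) → A) (s : Fin (n + 2) → Bool) : A :=
  c (sn s false) + if s (Fin.last n).castSucc ∧ s (Fin.last (n + 1)) then
    c (sn (sn (sn (fun i => s i.castSucc.castSucc) false) false) true) else 0

/-- The coefficients of `f (d₁, …, dₙ, 0, 0, dₙ₊₁)`. -/
def eCoeff (c : (Fin (n + 3) → Bool) → A) (t : Fin (n + 1) → Bool) : A :=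
  c (sn (sn (sn (fun i => t i.castSucc) false) false) (t (Fin.last n)))

lemma sum_mon_j₁ (c : (Fin (n + 3) → Bool) → A) (x : Fin (n + 2) → A) (hx : ∀ i, x i * x i = 0) :
    ∑ s, c s * mon (Fin.snoc (α := fun _ => A) x (x (Fin.last n).castSucc * x (Fin.last (n + 1)))) s
      = ∑ s, j₁Coeff c s * mon x s := by
  have h1 := hx (Fin.last n).castSucc
  have h2 := hx (Fin.last (n + 1))
  simp only [sum_sn, mon_sn, j₁Coeff, Fin.snoc_castSucc, Fin.snoc_last]
  refine Finset.sum_congr rfl fun s _ => ?_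
  generalize mon (A := A) _ s = u
  generalize x (Fin.last n).castSucc = y at *
  generalize x (Fin.last (n + 1)) = z at *
  simp only [Bool.false_eq_true, if_false, if_true, and_false, and_true]
  -- With `y`, `z` the last two variables, terms that contain `yz` from the new slot and also `y` or
  -- `z` have a square factor; only the pure `yz` term survives and is added to the coefficient of
  -- `yz`.
  linear_combination (c (sn (sn (sn s false) true) true) * u * y +
    c (sn (sn (sn s true) true) true) * u * y * y) * h2 +
    c (sn (sn (sn s true) false) true) * u * z * h1

lemma sum_mon_j₂ (c : (Fin (n + 3) → Bool) → A) (x : Fin (n + 2) → A) :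
    ∑ s, c s * mon (Fin.snoc (α := fun _ => A) x 0) s = ∑ s, c (sn s false) * mon x s := by
  rw [sum_sn]
  simp [mon_sn]

lemma sum_mon_e (c : (Fin (n + 3) → Bool) → A) (x : Fin (n + 1) → A) :
    ∑ s, c s * mon (Fin.snoc (α := fun _ => A) (Fin.snoc (α := fun _ => A)
      (Fin.snoc (α := fun _ => A) (fun i => x i.castSucc) 0) 0) (x (Fin.last n))) s =
      ∑ s, eCoeff c s * mon x s := by
  simp [sum_sn, mon_sn, eCoeff]

end Monomials

/-! ### Strong differences and tangent sums of functions with values in `R`. -/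

section QuasiColimits

variable {C : Type u} [Category.{v} C] [CartesianMonoidalCategory C] [BraidedCategory C]
  {R : C} [CommRingObj R]

/-- Change of stage, as a ring homomorphism. -/
def compHom {X Y : C} (f : X ⟶ Y) : (Y ⟶ R) →+* (X ⟶ R) where
  toFun r := f ≫ r
  map_one' := MonObj.comp_one f
  map_mul' := MonObj.comp_mul f
  map_zero' := AddMonObj.comp_zero f
  map_add' := AddMonObj.comp_add f

lemma compHom_apply {X Y : C} (f : X ⟶ Y) (r : Y ⟶ R) : compHom f r = f ≫ r := rfl

variable [HasFiniteLimits C] {n : ℕ} {p : Finset (Fin n × Fin n)} {X : C}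

lemma whisker_expand {S : C} (f : S ⟶ D R n p) (a : (Fin n → Bool) → (X ⟶ R)) :
    f ▷ X ≫ expand p a = ∑ s, (snd _ X ≫ a s) * mon (fun i => fst _ X ≫ f ≫ coord i) s := by
  rw [← compHom_apply, expand, map_sum]
  refine Finset.sum_congr rfl fun s _ => ?_
  rw [map_mul, map_mon]
  simp only [compHom_apply, whiskerRight_snd_assoc, whiskerRight_fst_assoc]

lemma incl_expand (a : (Fin n → Bool) → (X ⟶ R)) :
    incl p ▷ X ≫ expand ∅ a = expand p a := by
  rw [whisker_expand]
  simp only [incl, mk_coord, expand]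

lemma permute_expand (σ : Equiv.Perm (Fin n)) (a : (Fin n → Bool) → (X ⟶ R)) :
    permute σ ▷ X ≫ expand ∅ a = expand ∅ fun s => a (s ∘ ⇑σ⁻¹) := by
  rw [whisker_expand]
  simp only [permute, mk_coord, expand]
  rw [← (Equiv.arrowCongr σ (Equiv.refl Bool)).sum_comp]
  refine Finset.sum_congr rfl fun s _ => ?_
  congr 1
  rw [mon, mon]
  exact Fintype.prod_equiv σ⁻¹ _ _ fun i => rfl

lemma j₁_coord (i : Fin (n + 3)) : (j₁ n : D R (n + 2) ∅ ⟶ _) ≫ coord i =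
    Fin.snoc (α := fun _ => D R (n + 2) ∅ ⟶ R) coord
      (coord (Fin.last n).castSucc * coord (Fin.last (n + 1))) i :=
  mk_coord _ _ _ i

lemma j₂_coord (i : Fin (n + 3)) : (j₂ n : D R (n + 2) ∅ ⟶ _) ≫ coord i =
    Fin.snoc (α := fun _ => D R (n + 2) ∅ ⟶ R) coord 0 i :=
  mk_coord _ _ _ i

lemma e_coord (i : Fin (n + 3)) : (e n : D R (n + 1) ∅ ⟶ _) ≫ coord i =
    Fin.snoc (α := fun _ => D R (n + 1) ∅ ⟶ R)
      (Fin.snoc (α := fun _ => D R (n + 1) ∅ ⟶ R)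
        (Fin.snoc (α := fun _ => D R (n + 1) ∅ ⟶ R) (fun i => coord i.castSucc) 0) 0)
      (coord (Fin.last n)) i :=
  mk_coord _ _ _ i

lemma j₁_expand (c : (Fin (n + 3) → Bool) → (X ⟶ R)) :
    j₁ n ▷ X ≫ expand (rel n) c = expand ∅ (j₁Coeff c) := by
  rw [whisker_expand]
  have := sum_mon_j₁ (fun s => snd (D R (n + 2) ∅) X ≫ c s) (fun i => fst _ X ≫ coord i)
    (fun i => by rw [← MonObj.comp_mul, coord_mul_self, AddMonObj.comp_zero])
  simp only [j₁_coord, expand]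
  convert this using 5 with s _ i s _
  · refine Fin.lastCases ?_ (fun i => ?_) i <;> simp [MonObj.comp_mul]
  · simp only [j₁Coeff, AddMonObj.comp_add]
    split_ifs <;> simp [AddMonObj.comp_zero]

lemma j₂_expand (c : (Fin (n + 3) → Bool) → (X ⟶ R)) :
    j₂ n ▷ X ≫ expand (rel n) c = expand ∅ fun s => c (sn s false) := by
  rw [whisker_expand]
  have := sum_mon_j₂ (fun s => snd (D R (n + 2) ∅) X ≫ c s) (fun i => fst _ X ≫ coord i)
  simp only [j₂_coord, expand]
  convert this using 5 with s _ i
  refine Fin.lastCases ?_ (fun i => ?_) i <;> simp [AddMonObj.comp_zero]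

lemma e_expand (c : (Fin (n + 3) → Bool) → (X ⟶ R)) :
    e n ▷ X ≫ expand (rel n) c = expand ∅ (eCoeff c) := by
  rw [whisker_expand]
  have := sum_mon_e (fun s => snd (D R (n + 1) ∅) X ≫ c s) (fun i => fst _ X ≫ coord i)
  simp only [e_coord, expand]
  convert this using 5 with s _ i
  swap
  · rfl
  refine Fin.lastCases ?_ (fun i => ?_) i
  · simp
  · refine Fin.lastCases ?_ (fun i => ?_) i
    · simp [AddMonObj.comp_zero]
    · refine Fin.lastCases ?_ (fun i => ?_) i <;> simp [AddMonObj.comp_zero]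

lemma sn_default_zero (s : Fin 0 → Bool) (b : Bool) : sn s b 0 = b := rfl

lemma sn_sn_default (s : Fin 0 → Bool) (a b : Bool) : sn (sn s a) b = ![a, b] := by
  ext i
  fin_cases i <;> rfl

lemma i₁_expand (c : (Fin 2 → Bool) → (X ⟶ R)) :
    i₁ ▷ X ≫ expand {(0, 1)} c = expand ∅ fun t => c ![t 0, false] := by
  rw [whisker_expand]
  simp [i₁, expand, sum_sn, mon_sn, mon_zero, sn_default_zero, sn_sn_default, AddMonObj.comp_zero]

lemma i₂_expand (c : (Fin 2 → Bool) → (X ⟶ R)) :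
    i₂ ▷ X ≫ expand {(0, 1)} c = expand ∅ fun t => c ![false, t 0] := by
  rw [whisker_expand]
  simp [i₂, expand, sum_sn, mon_sn, mon_zero, sn_default_zero, sn_sn_default, AddMonObj.comp_zero]

lemma diag_expand (c : (Fin 2 → Bool) → (X ⟶ R)) :
    diag ▷ X ≫ expand {(0, 1)} c = expand ∅ fun t =>
      if t 0 then c ![true, false] + c ![false, true] else c ![false, false] := by
  rw [whisker_expand]
  have h : (fst (D R 1 ∅) X ≫ coord 0) * (fst (D R 1 ∅) X ≫ coord 0) = (0 : _ ⟶ R) := by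
    rw [← MonObj.comp_mul, coord_mul_self, AddMonObj.comp_zero]
  simp [diag, expand, sum_sn, mon_sn, mon_zero, sn_default_zero, sn_sn_default,
    AddMonObj.comp_add, h]
  ring

variable {k : Type w} [CommRing k] [AlgebraObj k R]

/-- Restricting to `D ^ n {(i, j)}` loses precisely the monomials divisible by `dᵢdⱼ`. All
hypotheses on cubes are used in this form. -/
theorem agreeOn_expand_iff (hR : KockLawvere k R) {i j : Fin n} (hij : i ≠ j)
    {a b : (Fin n → Bool) → (X ⟶ R)} :
    AgreeOn {(i, j)} (expand ∅ a) (expand ∅ b) ↔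
      ∀ s, ¬(s i = true ∧ s j = true) → a s = b s := by
  rw [AgreeOn, incl_expand, incl_expand, expand_eq_iff hR]
  simp [Indep, hij]

lemma indep_empty (s : Fin n → Bool) : Indep ∅ s := by simp [Indep]

theorem expand_empty_eq_iff (hR : KockLawvere k R) {a b : (Fin n → Bool) → (X ⟶ R)} :
    expand ∅ a = expand ∅ b ↔ a = b := by
  rw [expand_eq_iff hR]
  exact ⟨fun h => funext fun s => h s (indep_empty s), fun h s _ => by rw [h]⟩

/-- A function on `D ^ (n+3) {(n+1,n+3), (n+2,n+3)}` is determined by its restrictions. -/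
theorem strongDiff_ext (hR : KockLawvere k R) {ν ν' : D R (n + 3) (rel n) ⊗ X ⟶ R}
    (h₁ : j₁ n ▷ X ≫ ν = j₁ n ▷ X ≫ ν') (h₂ : j₂ n ▷ X ≫ ν = j₂ n ▷ X ≫ ν') : ν = ν' := by
  obtain ⟨c, rfl⟩ := exists_expand hR ν
  obtain ⟨c', rfl⟩ := exists_expand hR ν'
  rw [j₁_expand, j₁_expand, expand_empty_eq_iff hR] at h₁
  rw [j₂_expand, j₂_expand, expand_empty_eq_iff hR] at h₂
  rw [expand_eq_iff hR]
  intro s hs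
  obtain ⟨s, b, rfl⟩ := exists_sn s
  cases b
  · exact congrFun h₂ s
  · obtain ⟨s, b₂, rfl⟩ := exists_sn s
    obtain ⟨s, b₁, rfl⟩ := exists_sn s
    have e1 := hs ((Fin.last n).castSucc.castSucc, Fin.last (n + 2)) (by simp [rel])
      (Fin.castSucc_lt_last _).ne
    have e2 := hs ((Fin.last (n + 1)).castSucc, Fin.last (n + 2)) (by simp [rel])
      (Fin.castSucc_lt_last _).ne
    simp only [Fin.snoc_castSucc, Fin.snoc_last, and_true, Bool.not_eq_true] at e1 e2
    subst e1 e2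
    -- When the last variable occurs, the relations exclude the two before it. Along `j₁` this
    -- coefficient is added to that of `dₙ₊₁dₙ₊₂`, and the latter is known from `j₂`.
    have := congrFun h₁ (sn (sn s true) true)
    have h2' := congrFun h₂ (sn (sn s true) true)
    simpa [j₁Coeff, show c (sn (sn (sn s true) true) false) = _ from h2'] using this

/-- The coefficients of the strong difference of two functions with coefficients `a` and `b`. -/
def sdCoeff {A : Type*} [CommRing A] (a b : (Fin (n + 2) → Bool) → A)
    (t : Fin (n + 1) → Bool) : A :=
  if t (Fin.last n) then a (sn t true) - b (sn t true) else b (sn t false)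

/-- The interpolating function is the second one plus the difference of the two with `dₙ₊₁dₙ₊₂`
replaced by the new variable; the hypothesis makes that difference divisible by `dₙ₊₁dₙ₊₂`. -/
theorem exists_strongDiff {a b : (Fin (n + 2) → Bool) → (X ⟶ R)}
    (h : ∀ s, ¬(s (Fin.last n).castSucc = true ∧ s (Fin.last (n + 1)) = true) → a s = b s) :
    ∃ ν : D R (n + 3) (rel n) ⊗ X ⟶ R, j₁ n ▷ X ≫ ν = expand ∅ a ∧ j₂ n ▷ X ≫ ν = expand ∅ b ∧
      e n ▷ X ≫ ν = expand ∅ (sdCoeff a b) := by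
  let c (s : Fin (n + 3) → Bool) : X ⟶ R :=
    if s (Fin.last (n + 2)) then
      a (sn (sn (fun i => s i.castSucc.castSucc.castSucc) true) true) -
        b (sn (sn (fun i => s i.castSucc.castSucc.castSucc) true) true)
    else b fun i => s i.castSucc
  refine ⟨expand _ c, ?_, ?_, ?_⟩
  · rw [j₁_expand]
    congr 1
    ext1 s
    obtain ⟨s, b₂, rfl⟩ := exists_sn s
    obtain ⟨s, b₁, rfl⟩ := exists_sn s
    by_cases hb : b₁ = true ∧ b₂ = true
    · simp [j₁Coeff, c, hb.1, hb.2]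
    · rw [h _ (by simpa using hb)]
      simp only [j₁Coeff, c, Fin.snoc_castSucc, Fin.snoc_last]
      simp [hb]
  · rw [j₂_expand]
    simp [c]
  · rw [e_expand]
    congr 1
    ext1 t
    obtain ⟨t, b₁, rfl⟩ := exists_sn t
    cases b₁ <;> simp [eCoeff, c, sdCoeff]

/-- A function on `D(2)` is determined by its restrictions to the axes. -/
theorem tangentAdd_ext (hR : KockLawvere k R) {ν ν' : D R 2 {(0, 1)} ⊗ X ⟶ R}
    (h₁ : i₁ ▷ X ≫ ν = i₁ ▷ X ≫ ν') (h₂ : i₂ ▷ X ≫ ν = i₂ ▷ X ≫ ν') : ν = ν' := by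
  obtain ⟨c, rfl⟩ := exists_expand hR ν
  obtain ⟨c', rfl⟩ := exists_expand hR ν'
  rw [i₁_expand, i₁_expand, expand_empty_eq_iff hR] at h₁
  rw [i₂_expand, i₂_expand, expand_empty_eq_iff hR] at h₂
  rw [expand_eq_iff hR]
  intro s hs
  have e1 := hs (0, 1) (by simp) (by decide)
  have hs' : s = ![s 0, s 1] := by ext i; fin_cases i <;> rfl
  by_cases h0 : s 0 = true
  · have h1 : s 1 = false := by simpa [h0] using e1
    rw [hs', h1]
    exact congrFun h₁ fun _ => s 0
  · rw [Bool.not_eq_true] at h0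
    rw [hs', h0]
    exact congrFun h₂ fun _ => s 1

/-- The coefficients of the sum of two tangent vectors with coefficients `a` and `b`. -/
def taCoeff {A : Type*} [CommRing A] (a b : (Fin 1 → Bool) → A) (t : Fin 1 → Bool) : A :=
  if t 0 then a t + b t else a t

theorem exists_tangentAdd {a b : (Fin 1 → Bool) → (X ⟶ R)} (h : a ![false] = b ![false]) :
    ∃ ν : D R 2 {(0, 1)} ⊗ X ⟶ R, i₁ ▷ X ≫ ν = expand ∅ a ∧ i₂ ▷ X ≫ ν = expand ∅ b ∧
      diag ▷ X ≫ ν = expand ∅ (taCoeff a b) := by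
  have ht : ∀ t : Fin 1 → Bool, t = ![t 0] := fun t => by ext i; fin_cases i; rfl
  refine ⟨expand _ fun s => if s 1 then b ![true] else a ![s 0], ?_, ?_, ?_⟩
  · rw [i₁_expand]
    congr 1
    ext1 t
    rw [ht t]
    simp
  · rw [i₂_expand]
    congr 1
    ext1 t
    rw [ht t]
    cases t 0 <;> simp [h]
  · rw [diag_expand]
    congr 1
    ext1 t
    rw [ht t]
    cases t 0 <;> simp [taCoeff]

end QuasiColimits

/-! ### The quasi-pushouts behind strong differences and sums, transferred to `M`. -/

section Microlinear

variable {C : Type u} [Category.{v} C] [CartesianMonoidalCategory C] [BraidedCategory C]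
  [HasFiniteLimits C] {k : Type w} [CommRing k] {R : C} [CommRingObj R] [AlgebraObj k R]

/-- The commuting square of the quasi-pushout: the last coordinates `dₙ₊₁dₙ₊₂` and 0 coincide where
the product vanishes. -/
lemma incl_j₁ (n : ℕ) :
    (incl {((Fin.last n).castSucc, Fin.last (n + 1))} : _ ⟶ D R (n + 2) ∅) ≫ j₁ n =
    incl {((Fin.last n).castSucc, Fin.last (n + 1))} ≫ j₂ n := by
  refine D_hom_ext fun i => ?_
  simp only [Category.assoc, j₁_coord, j₂_coord]
  refine Fin.lastCases ?_ (fun i => ?_) i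
  · simp only [Fin.snoc_last, MonObj.comp_mul, AddMonObj.comp_zero, incl, mk_coord]
    exact coord_mul_coord (by simp)
  · simp

/-- The inclusion of the origin. -/
noncomputable def origin (R : C) [CommRingObj R] (n : ℕ) : D R 0 ∅ ⟶ D R n ∅ :=
  mk (fun _ => 0) (by simp) (by simp)

lemma origin_i₁ : origin R 1 ≫ i₁ = origin R 1 ≫ i₂ := by
  refine D_hom_ext fun i => ?_
  simp only [i₁, i₂, Category.assoc, mk_coord]
  fin_cases i <;> simp [origin, AddMonObj.comp_zero]

lemma origin_expand {n : ℕ} {X : C} (a : (Fin n → Bool) → (X ⟶ R)) :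
    origin R n ▷ X ≫ expand ∅ a = expand ∅ fun _ => a fun _ => false := by
  rw [whisker_expand]
  simp only [origin, mk_coord, expand, AddMonObj.comp_zero]
  rw [Finset.sum_eq_single fun _ => false]
  · simp [mon]
  · intro s _ hs
    obtain ⟨i, hi⟩ : ∃ i, s i = true := by
      by_contra h
      push Not at h
      exact hs (funext fun i => by simpa using h i)
    rw [mon, Finset.prod_eq_zero (Finset.mem_univ i), mul_zero]
    simp [hi]
  · simp

variable [MonoidalClosed C] {M : C}

/-- In a microlinear object, strong differences exist and are computed by any interpolating
mapping. -/
theorem Microlinear.strongDiff_eq_some (hM : Microlinear k R M) (hR : KockLawvere k R) {n : ℕ}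
    {X : C} {γ₁ γ₂ : Cube R X M (n + 2)} {ν : D R (n + 3) (rel n) ⊗ X ⟶ M}
    (h₁ : j₁ n ▷ X ≫ ν = γ₁) (h₂ : j₂ n ▷ X ≫ ν = γ₂) :
    strongDiff γ₁ γ₂ = Part.some (e n ▷ X ≫ ν) := by
  have hdom : ∃! ν : D R (n + 3) (rel n) ⊗ X ⟶ M, j₁ n ▷ X ≫ ν = γ₁ ∧ j₂ n ▷ X ≫ ν = γ₂ := by
    refine hM.glue_pair (incl_j₁ n) (isSmall_D k R _) (isSmall_D k R _) (isSmall_D k R _) ?_ _ _ ?_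
    · intro X φ₁ φ₂ h
      obtain ⟨a, rfl⟩ := exists_expand hR φ₁
      obtain ⟨b, rfl⟩ := exists_expand hR φ₂
      obtain ⟨ν, h₁, h₂, -⟩ :=
        exists_strongDiff ((agreeOn_expand_iff hR (Fin.castSucc_lt_last _).ne).1 h)
      exact ⟨ν, ⟨h₁, h₂⟩, fun ν' h' => strongDiff_ext hR (h'.1.trans h₁.symm) (h'.2.trans h₂.symm)⟩
    · rw [← h₁, ← h₂, ← comp_whiskerRight_assoc, incl_j₁, comp_whiskerRight_assoc]
  refine Part.eq_some_iff.2 ⟨hdom, ?_⟩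
  change e n ▷ X ≫ hdom.choose = _
  rw [hdom.choose_spec.2 ν ⟨h₁, h₂⟩]

theorem Microlinear.tangentAdd_eq_some (hM : Microlinear k R M) (hR : KockLawvere k R)
    {X : C} {t₁ t₂ : Cube R X M 1} {ν : D R 2 {(0, 1)} ⊗ X ⟶ M}
    (h₁ : i₁ ▷ X ≫ ν = t₁) (h₂ : i₂ ▷ X ≫ ν = t₂) :
    tangentAdd t₁ t₂ = Part.some (diag ▷ X ≫ ν) := by
  have hdom : ∃! ν : D R 2 {(0, 1)} ⊗ X ⟶ M, i₁ ▷ X ≫ ν = t₁ ∧ i₂ ▷ X ≫ ν = t₂ := by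
    refine hM.glue_pair origin_i₁ (isSmall_D k R _) (isSmall_D k R _) (isSmall_D k R _) ?_ _ _ ?_
    · intro X φ₁ φ₂ h
      obtain ⟨a, rfl⟩ := exists_expand hR φ₁
      obtain ⟨b, rfl⟩ := exists_expand hR φ₂
      rw [origin_expand, origin_expand, expand_empty_eq_iff hR] at h
      have h0 : (![false] : Fin 1 → Bool) = fun _ => false :=
        funext fun i => by fin_cases i; rfl
      have h' : a ![false] = b ![false] := by
        rw [h0]
        exact congrFun h fun _ => false
      obtain ⟨ν, h₁, h₂, -⟩ := exists_tangentAdd h'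
      exact ⟨ν, ⟨h₁, h₂⟩, fun ν' h' => tangentAdd_ext hR (h'.1.trans h₁.symm) (h'.2.trans h₂.symm)⟩
    · rw [← h₁, ← h₂, ← comp_whiskerRight_assoc, origin_i₁, comp_whiskerRight_assoc]
  refine Part.eq_some_iff.2 ⟨hdom, ?_⟩
  change diag ▷ X ≫ hdom.choose = _
  rw [hdom.choose_spec.2 ν ⟨h₁, h₂⟩]

end Microlinear

/-! ### Mappings into spectra, and existence of spectra of free algebras. -/

section Spec

variable {C : Type u} [Category.{v} C] [CartesianMonoidalCategory C] [BraidedCategory C]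
  {k : Type w} [CommRing k] {R : C} [CommRingObj R] [AlgebraObj k R]

lemma IsSpec.hom_ext {W : Type w} [CommRing W] [Algebra k W] {G : C} {x : W →ₐ[k] (G ⟶ R)}
    (hx : IsSpec k R x) {Y : C} {f g : Y ⟶ G} (h : ∀ a, f ≫ x a = g ≫ x a) : f = g :=
  (hx Y ((precomp k R g).comp x)).unique (AlgHom.ext h) rfl

/-- Mappings into `Spec_R W` can be glued if the corresponding functions can. -/
theorem IsSpec.glue_pair {W : Type w} [CommRing W] [Algebra k W] {G : C} {x : W →ₐ[k] (G ⟶ R)}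
    (hx : IsSpec k R x) {S T X : C} {u₁ u₂ : S ⟶ T}
    (hu : ∀ ν ν' : T ⊗ X ⟶ R, u₁ ▷ X ≫ ν = u₁ ▷ X ≫ ν' → u₂ ▷ X ≫ ν = u₂ ▷ X ≫ ν' → ν = ν')
    (δ₁ δ₂ : S ⊗ X ⟶ G)
    (h : ∀ a, ∃ ν : T ⊗ X ⟶ R, u₁ ▷ X ≫ ν = δ₁ ≫ x a ∧ u₂ ▷ X ≫ ν = δ₂ ≫ x a) :
    ∃ ν : T ⊗ X ⟶ G, u₁ ▷ X ≫ ν = δ₁ ∧ u₂ ▷ X ≫ ν = δ₂ := by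
  choose ν h₁ h₂ using h
  -- Uniqueness of the glued functions makes `ν` an algebra homomorphism, hence a mapping into the
  -- spectrum.
  let Φ : W →ₐ[k] (T ⊗ X ⟶ R) :=
    { toFun := ν
      map_one' := hu _ _ (by rw [h₁, map_one, MonObj.comp_one, MonObj.comp_one])
        (by rw [h₂, map_one, MonObj.comp_one, MonObj.comp_one])
      map_mul' := fun a b => hu _ _
        (by rw [h₁, map_mul, MonObj.comp_mul, MonObj.comp_mul, h₁, h₁])
        (by rw [h₂, map_mul, MonObj.comp_mul, MonObj.comp_mul, h₂, h₂])
      map_zero' := hu _ _ (by rw [h₁, map_zero, AddMonObj.comp_zero, AddMonObj.comp_zero])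
        (by rw [h₂, map_zero, AddMonObj.comp_zero, AddMonObj.comp_zero])
      map_add' := fun a b => hu _ _
        (by rw [h₁, map_add, AddMonObj.comp_add, AddMonObj.comp_add, h₁, h₁])
        (by rw [h₂, map_add, AddMonObj.comp_add, AddMonObj.comp_add, h₂, h₂])
      commutes' := fun r => hu _ _
        (by rw [h₁, AlgHom.commutes, ← precomp_apply (k := k), ← precomp_apply (k := k),
          AlgHom.commutes, AlgHom.commutes])
        (by rw [h₂, AlgHom.commutes, ← precomp_apply (k := k), ← precomp_apply (k := k),
          AlgHom.commutes, AlgHom.commutes]) }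
  obtain ⟨f, hf, -⟩ := hx _ Φ
  have hf' (a) : f ≫ x a = ν a := DFunLike.congr_fun hf a
  exact ⟨f, hx.hom_ext fun a => by rw [Category.assoc, hf', h₁],
    hx.hom_ext fun a => by rw [Category.assoc, hf', h₂]⟩

lemma comp_smul {X Y : C} (f : X ⟶ Y) (r : k) (g : Y ⟶ R) : f ≫ (r • g) = r • (f ≫ g) :=
  map_smul (precomp k R f) r g

lemma comp_sum {X Y : C} {ι : Type*} (f : X ⟶ Y) (s : Finset ι) (g : ι → (Y ⟶ R)) :
    f ≫ (∑ i ∈ s, g i) = ∑ i ∈ s, f ≫ g i :=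
  map_sum (compHom f) g s

/-- If `W` is free of finite rank then `Spec_R W` exists. -/
theorem exists_isSpec [HasFiniteLimits C] {W : Type w} [CommRing W] [Algebra k W] {Q : Type}
    [Fintype Q] (b : Module.Basis Q k W) : ∃ (G : C) (x : W →ₐ[k] (G ⟶ R)), IsSpec k R x := by
  let P : C := ∏ᶜ fun _ : Q => R
  let π (q : Q) : P ⟶ R := Pi.π (fun _ : Q => R) q
  -- The spectrum is carved out of `R ^ Q` by the structure constants: `none` carries the equation
  -- for the unit, `some (p, q)` the one for `b p * b q`.
  let l : P ⟶ ∏ᶜ fun _ : Option (Q × Q) => R :=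
    Pi.lift fun o => o.elim 1 fun q => π q.1 * π q.2
  let r : P ⟶ ∏ᶜ fun _ : Option (Q × Q) => R :=
    Pi.lift fun o => ∑ q, b.repr (o.elim 1 fun q => b q.1 * b q.2) q • π q
  let y (q : Q) : equalizer l r ⟶ R := equalizer.ι l r ≫ π q
  have hlr (o : Option (Q × Q)) := congrArg (· ≫ Pi.π (fun _ => R) o) (equalizer.condition l r)
  simp only [l, r, Category.assoc, limit.lift_π, Fan.mk_π_app] at hlr
  let f : W →ₗ[k] (equalizer l r ⟶ R) := b.constr k y
  have hf (a : W) : f a = ∑ q, b.repr a q • y q := b.constr_apply_fintype k y a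
  have h1 : f 1 = 1 := by
    have := hlr none
    simp only [Option.elim_none, MonObj.comp_one, comp_sum, comp_smul] at this
    rw [hf, this]
  have h2 (p q : Q) : f (b p * b q) = y p * y q := by
    have := hlr (some (p, q))
    simp only [Option.elim_some, MonObj.comp_mul, comp_sum, comp_smul] at this
    rw [hf, ← this]
  have hb (q : Q) : f (b q) = y q := b.constr_basis k y q
  have h3 : (LinearMap.mul k W).compr₂ f = (LinearMap.mul k _).compl₁₂ f f :=
    b.ext fun p => b.ext fun q => by simp [h2, hb]
  let x : W →ₐ[k] (equalizer l r ⟶ R) :=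
    AlgHom.ofLinearMap f h1 fun a a' => LinearMap.congr_fun₂ h3 a a'
  have hxb (q : Q) : x (b q) = y q := hb q
  refine ⟨equalizer l r, x, fun X φ => ?_⟩
  have hφ (a : W) : φ a = ∑ q, b.repr a q • φ (b q) := by
    conv_lhs => rw [← b.sum_repr a, map_sum]
    simp only [map_smul]
  have hlift : Pi.lift (fun q => φ (b q)) ≫ l = Pi.lift (fun q => φ (b q)) ≫ r := by
    refine Pi.hom_ext _ _ fun o => ?_
    simp only [l, r, Category.assoc, limit.lift_π, Fan.mk_π_app]
    rcases o with _ | ⟨p, q⟩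
    · simp only [Option.elim_none, MonObj.comp_one, comp_sum, comp_smul, π, limit.lift_π,
        Fan.mk_π_app]
      rw [← hφ, map_one]
    · simp only [Option.elim_some, MonObj.comp_mul, comp_sum, comp_smul, π, limit.lift_π,
        Fan.mk_π_app]
      rw [← hφ, map_mul]
  have hy (q : Q) : equalizer.lift _ hlift ≫ y q = φ (b q) := by
    simp only [y, π, equalizer.lift_ι_assoc, limit.lift_π, Fan.mk_π_app]
  refine ⟨equalizer.lift _ hlift, ?_, ?_⟩
  · refine AlgHom.toLinearMap_injective (b.ext fun q => ?_)
    simp only [AlgHom.toLinearMap_apply, AlgHom.comp_apply, precomp_apply, hxb, hy]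
  · rintro g rfl
    refine equalizer.hom_ext (Pi.hom_ext _ _ fun q => ?_)
    have : g ≫ y q = equalizer.lift _ hlift ≫ y q := by
      rw [hy, AlgHom.comp_apply, hxb, precomp_apply]
    simpa only [Category.assoc, y, π] using this

end Spec

/-! ### Restriction of functions to `D ^ n {p}` inside the Weil algebras. -/

section Restriction

variable (k : Type w) [CommRing k] {n : ℕ}

/-- Restriction of functions from `D ^ n` to `D ^ n {p}`. -/
noncomputable def FunAlg.restrict (p : Finset (Fin n × Fin n)) :
    FunAlg k (∅ : Finset (Fin n × Fin n)) →ₐ[k] FunAlg k p :=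
  FunAlg.eval k ∅ (FunAlg.X k p) (fun _ => FunAlg.X_mul_X k p (Or.inl rfl)) (by simp)

lemma FunAlg.restrict_mk (p : Finset (Fin n × Fin n)) (f : MvPolynomial (Fin n) k) :
    FunAlg.restrict k p (Ideal.Quotient.mk _ f) = Ideal.Quotient.mk _ f := by
  change MvPolynomial.aeval (FunAlg.X k p) f = Ideal.Quotient.mkₐ k _ f
  congr 1
  exact MvPolynomial.algHom_ext fun i => MvPolynomial.aeval_X _ _

/-- The coefficient of a monomial in a function on `D ^ n`. -/
noncomputable def FunAlg.coeff (s : Fin n → Bool) : FunAlg k (∅ : Finset (Fin n × Fin n)) →ₗ[k] k :=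
  (LinearMap.proj ⟨s, indep_empty s⟩).comp (FunAlg.coeffEquiv k ∅).toLinearMap

/-- The counterpart of `agreeOn_expand_iff` for scalar coefficients. The two match, which is why the
universal family over `k` governs families at every stage. -/
lemma FunAlg.restrict_eq_iff {i j : Fin n} (hij : i ≠ j)
    (a b : FunAlg k (∅ : Finset (Fin n × Fin n))) :
    FunAlg.restrict k {(i, j)} a = FunAlg.restrict k {(i, j)} b ↔
      ∀ s, ¬(s i = true ∧ s j = true) → FunAlg.coeff k s a = FunAlg.coeff k s b := by
  have h (s : Fin n → Bool) : Indep {(i, j)} s ↔ ¬(s i = true ∧ s j = true) := by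
    simp [Indep, hij]
  rw [← (FunAlg.coeffEquiv k {(i, j)}).injective.eq_iff, funext_iff]
  have hc (a : FunAlg k (∅ : Finset (Fin n × Fin n))) (s) :
      FunAlg.coeffEquiv k {(i, j)} (FunAlg.restrict k {(i, j)} a) s = FunAlg.coeff k s.1 a := by
    obtain ⟨f, rfl⟩ := Ideal.Quotient.mk_surjective a
    rw [FunAlg.restrict_mk]
    rfl
  simp only [hc, Subtype.forall, h]

/-- The function on `D ^ n` with given coefficients. -/
noncomputable def FunAlg.ofCoeff :
    ((Fin n → Bool) → k) →ₗ[k] FunAlg k (∅ : Finset (Fin n × Fin n)) :=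
  (FunAlg.coeffEquiv k ∅).symm.toLinearMap.comp (LinearMap.funLeft k k Subtype.val)

lemma FunAlg.coeff_ofCoeff (a : (Fin n → Bool) → k) (s : Fin n → Bool) :
    FunAlg.coeff k s (FunAlg.ofCoeff k a) = a s := by
  simp [FunAlg.coeff, FunAlg.ofCoeff, LinearMap.funLeft_apply]

lemma FunAlg.ofCoeff_coeff (a : FunAlg k (∅ : Finset (Fin n × Fin n))) :
    FunAlg.ofCoeff k (fun s => FunAlg.coeff k s a) = a :=
  (FunAlg.coeffEquiv k ∅).symm_apply_apply a

lemma FunAlg.ofCoeff_eq_sum (a : (Fin n → Bool) → k) :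
    FunAlg.ofCoeff k a = ∑ s, a s • mon (FunAlg.X k ∅) s := by
  classical
  have : a = ∑ s, a s • Pi.single s 1 := by
    ext t
    simp [Finset.sum_apply, Pi.single_apply]
  conv_lhs => rw [this, map_sum]
  refine Finset.sum_congr rfl fun s _ => ?_
  rw [map_smul, ← FunAlg.coeffEquiv_symm_single k ∅ ⟨s, indep_empty s⟩]
  refine congrArg _ (congrArg (FunAlg.coeffEquiv k ∅).symm (funext fun t => ?_))
  simp [LinearMap.funLeft_apply, Pi.single_apply, Subtype.ext_iff]

variable {C : Type u} [Category.{v} C] [CartesianMonoidalCategory C] [BraidedCategory C]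
  [HasFiniteLimits C] {R : C} [CommRingObj R] [AlgebraObj k R]

lemma incl_toHom (p : Finset (Fin n × Fin n)) (a : FunAlg k (∅ : Finset (Fin n × Fin n))) :
    incl p ≫ (FunAlg.toHom k a : _ ⟶ R) = FunAlg.toHom k (FunAlg.restrict k p a) := by
  have : (precomp k R (incl p)).comp (FunAlg.toHom k) =
      (FunAlg.toHom k).comp (FunAlg.restrict k p) := by
    refine FunAlg.algHom_ext k _ fun i => ?_
    rw [AlgHom.comp_apply, AlgHom.comp_apply, FunAlg.restrict, FunAlg.eval_X, FunAlg.toHom_X,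
      FunAlg.toHom_X, precomp_apply, incl, mk_coord]
  exact DFunLike.congr_fun this a

end Restriction

/-! ### The universal compatible family of cubes indexed by words. -/

section Words

variable (k : Type w) [CommRing k] (m : ℕ)

/-- The algebra of families of functions on `D ^ (m+1)`, indexed by words in `m + 1` letters, such
that the functions of two words which differ by the interchange of two neighbouring letters `p`, `q`
agree on `D ^ (m+1) {(p, q)}`. -/
def WordAlg : Subalgebra k
    (Equiv.Perm (Fin (m + 1)) → FunAlg k (∅ : Finset (Fin (m + 1) × Fin (m + 1)))) where
  carrier := {f | ∀ τ (i : Fin m), FunAlg.restrict k {(τ i.castSucc, τ i.succ)} (f τ) =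
    FunAlg.restrict k {(τ i.castSucc, τ i.succ)} (f (τ * Equiv.swap i.castSucc i.succ))}
  mul_mem' hf hg τ i := by
    simp only [Pi.mul_apply, map_mul]
    rw [hf, hg]
  add_mem' hf hg τ i := by
    simp only [Pi.add_apply, map_add]
    rw [hf, hg]
  algebraMap_mem' r τ i := by simp only [Pi.algebraMap_apply]

/-- Elementary moves on pairs of a word and a monomial. -/
def WordRel (a b : Equiv.Perm (Fin (m + 1)) × (Fin (m + 1) → Bool)) : Prop :=
  ∃ i : Fin m, b = (a.1 * Equiv.swap i.castSucc i.succ, a.2) ∧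
    ¬(a.2 (a.1 i.castSucc) = true ∧ a.2 (a.1 i.succ) = true)

/-- The classes of monomials in words. -/
abbrev WordMon : Type := Quot (WordRel m)

noncomputable instance : Fintype (WordMon m) := by
  classical exact Fintype.ofSurjective (Quot.mk _) Quot.mk_surjective

variable {m}

lemma ne_of_perm (τ : Equiv.Perm (Fin (m + 1))) (i : Fin m) : τ i.castSucc ≠ τ i.succ :=
  fun h => Fin.castSucc_lt_succ.ne (τ.injective h)

lemma WordAlg.coeff_eq (f : WordAlg k m) {a b : Equiv.Perm (Fin (m + 1)) × (Fin (m + 1) → Bool)}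
    (h : WordRel m a b) : FunAlg.coeff k a.2 (f.1 a.1) = FunAlg.coeff k b.2 (f.1 b.1) := by
  obtain ⟨i, rfl, hi⟩ := h
  exact (FunAlg.restrict_eq_iff k (ne_of_perm a.1 i) _ _).1 (f.2 a.1 i) _ hi

/-- The coordinates on the algebra of compatible families. -/
noncomputable def WordAlg.coords : WordAlg k m ≃ₗ[k] (WordMon m → k) where
  toFun f := Quot.lift (fun a => FunAlg.coeff k a.2 (f.1 a.1)) fun _ _ h => WordAlg.coeff_eq k f h
  map_add' f g := by
    ext ⟨a⟩
    exact map_add _ _ _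
  map_smul' r f := by
    ext ⟨a⟩
    exact (FunAlg.coeff k a.2).map_smul r (f.1 a.1)
  invFun c := ⟨fun τ => FunAlg.ofCoeff k fun s => c (Quot.mk _ (τ, s)), fun τ i => by
    rw [FunAlg.restrict_eq_iff k (ne_of_perm τ i)]
    intro s hs
    rw [FunAlg.coeff_ofCoeff, FunAlg.coeff_ofCoeff]
    exact congrArg c (Quot.sound ⟨i, rfl, hs⟩)⟩
  left_inv f := Subtype.ext (funext fun τ => FunAlg.ofCoeff_coeff k (f.1 τ))
  right_inv c := by
    ext ⟨a⟩
    exact FunAlg.coeff_ofCoeff k _ _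

lemma WordAlg.coords_symm_apply (c : WordMon m → k) (τ) :
    ((WordAlg.coords k).symm c).1 τ = FunAlg.ofCoeff k fun s => c (Quot.mk _ (τ, s)) := rfl

/-- A function on words which is invariant under neighbouring interchanges is constant. -/
lemma eq_one_of_swap_invariant {A : Type*} (f : Equiv.Perm (Fin (m + 1)) → A)
    (h : ∀ τ (i : Fin m), f τ = f (τ * Equiv.swap i.castSucc i.succ)) (τ) : f τ = f 1 := by
  have hτ : τ ∈ Submonoid.closure (Set.range fun i : Fin m ↦ Equiv.swap i.castSucc i.succ) := by
    rw [Equiv.Perm.mclosure_swap_castSucc_succ]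
    trivial
  induction hτ using Submonoid.closure_induction_right with
  | one => rfl
  | mul_right x _ y hy ih =>
    obtain ⟨i, rfl⟩ := hy
    rw [← h, ih]

/-- The empty monomial lies in one class for all words, so all components have zero constant term;
being finitely many, they have a common nilpotency exponent. -/
lemma WordAlg.isNilpotent (f : WordAlg k m)
    (hf : WordAlg.coords k f (Quot.mk _ (1, fun _ => false)) = 0) : IsNilpotent f := by
  have h (τ) : IsNilpotent (f.1 τ) := by
    refine FunAlg.isNilpotent k _ _ ?_
    change WordAlg.coords k f (Quot.mk _ (τ, fun _ => false)) = 0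
    rw [← hf]
    exact eq_one_of_swap_invariant (fun τ => WordAlg.coords k f (Quot.mk _ (τ, fun _ => false)))
      (fun τ i => congrArg _ (Quot.sound ⟨i, rfl, by simp⟩)) τ
  choose N hN using h
  refine ⟨∑ τ, N τ, Subtype.ext (funext fun τ => ?_)⟩
  have : N τ ≤ ∑ τ, N τ := Finset.single_le_sum (fun _ _ => Nat.zero_le _) (Finset.mem_univ τ)
  exact pow_eq_zero_of_le this (hN τ)

/-- The component of a word. -/
noncomputable def WordAlg.component (τ : Equiv.Perm (Fin (m + 1))) :
    WordAlg k m →ₐ[k] FunAlg k (∅ : Finset (Fin (m + 1) × Fin (m + 1))) :=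
  (Pi.evalAlgHom k _ τ).comp (WordAlg k m).val

theorem WordAlg.isWeilAlgebra : IsWeilAlgebra k (WordAlg k m) := by
  have h (f : WordAlg k m) : (FunAlg.eps k ∅).comp (WordAlg.component k 1) f =
      WordAlg.coords k f (Quot.mk _ (1, fun _ => false)) := FunAlg.eps_apply k ∅ (f.1 1)
  exact isWeilAlgebra_of_coordinates (WordAlg.coords k) _ _ h fun f hf =>
    WordAlg.isNilpotent k f (by rw [← h, hf])

variable {k}
variable {C : Type u} [Category.{v} C] [CartesianMonoidalCategory C] [BraidedCategory C]
  [HasFiniteLimits C] {R : C} [CommRingObj R] [AlgebraObj k R]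

lemma toHom_ofCoeff {n : ℕ} (a : (Fin n → Bool) → k) :
    (FunAlg.toHom k (FunAlg.ofCoeff k a) : _ ⟶ R) = ∑ s, a s • mon coord s := by
  rw [FunAlg.ofCoeff_eq_sum, map_sum]
  refine Finset.sum_congr rfl fun s _ => ?_
  rw [map_smul, map_mon]
  simp only [FunAlg.toHom_X]

/-- The universal compatible family of cubes, indexed by words, is a quasi-colimit. -/
theorem word_glue [MonoidalClosed C] (hR : KockLawvere k R) {G : C} {x : WordAlg k m →ₐ[k] (G ⟶ R)}
    (hx : IsSpec k R (W := WordAlg k m) x) {ι : Equiv.Perm (Fin (m + 1)) → (D R (m + 1) ∅ ⟶ G)}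
    (hι : ∀ τ f, ι τ ≫ x f = FunAlg.toHom k (f.1 τ)) {M : C} (hM : Microlinear k R M) {X : C}
    (γ : Equiv.Perm (Fin (m + 1)) → Cube R X M (m + 1))
    (hγ : ∀ (τ : Equiv.Perm (Fin (m + 1))) (i : Fin m),
      AgreeOn {(τ i.castSucc, τ i.succ)} (γ τ) (γ (τ * Equiv.swap i.castSucc i.succ))) :
    ∃ g : G ⊗ X ⟶ M, ∀ τ, ι τ ▷ X ≫ g = γ τ := by
  classical
  let J : MultispanShape.{0, 0} := ⟨Equiv.Perm (Fin (m + 1)) × Fin m, Equiv.Perm (Fin (m + 1)),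
    fun a => a.1, fun a => a.1 * Equiv.swap a.2.castSucc a.2.succ⟩
  let I : MultispanIndex J C := ⟨fun a => D R (m + 1) {(a.1 a.2.castSucc, a.1 a.2.succ)},
    fun _ => D R (m + 1) ∅, fun _ => incl _, fun _ => incl _⟩
  have : Fintype J.L := inferInstanceAs (Fintype (Equiv.Perm (Fin (m + 1)) × Fin m))
  have : Fintype J.R := inferInstanceAs (Fintype (Equiv.Perm (Fin (m + 1))))
  have hw (a : J.L) : I.fst a ≫ ι (J.fst a) = I.snd a ≫ ι (J.snd a) := hx.hom_ext fun f => by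
    simp only [I, Category.assoc, hι, incl_toHom]
    exact congrArg _ (f.2 a.1 a.2)
  suffices hglue : ∀ (X : C) (φ : ∀ i, I.right i ⊗ X ⟶ R),
      (∀ a, I.fst a ▷ X ≫ φ (J.fst a) = I.snd a ▷ X ≫ φ (J.snd a)) →
        ∃! ψ : G ⊗ X ⟶ R, ∀ i, ι i ▷ X ≫ ψ = φ i from
    (hM.glue I G ι hw (fun _ => isSmall_D k R _) (fun _ => isSmall_D k R _)
      ⟨_, _, _, WordAlg.isWeilAlgebra k, x, hx⟩ hglue X γ (fun a => hγ a.1 a.2)).exists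
  intro X φ hφ
  choose a ha using fun τ => exists_expand hR (φ τ)
  have hinv (τ) (i : Fin m) (s : Fin (m + 1) → Bool)
      (hs : ¬(s (τ i.castSucc) = true ∧ s (τ i.succ) = true)) :
      a τ s = a (τ * Equiv.swap i.castSucc i.succ) s := by
    refine (agreeOn_expand_iff hR (ne_of_perm τ i)).1 ?_ s hs
    have := hφ (τ, i)
    rw [← ha, ← ha] at this
    exact this
  -- Compatibility says exactly that the coefficients descend to classes, which index a basis of
  -- `WordAlg k m`.
  let b : WordMon m → (X ⟶ R) := Quot.lift (fun c => a c.1 c.2) (by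
    rintro c _ ⟨i, rfl, hi⟩
    exact hinv _ _ _ hi)
  have hbij := hR.bijective (WordAlg.isWeilAlgebra k) hx (WordAlg.coords k) X
  have hres (b : WordMon m → (X ⟶ R)) (τ) : ι τ ▷ X ≫ (∑ q, (snd G X ≫ b q) *
      (fst G X ≫ x ((WordAlg.coords k).symm (Pi.single q 1)))) =
      expand ∅ fun s => b (Quot.mk _ (τ, s)) := by
    -- The basis function of a class restricts, on the cube of `τ`, to the sum of the monomials `s`
    -- with `(τ, s)` in that class.
    have hsum (q : WordMon m) : ι τ ▷ X ≫ ((snd G X ≫ b q) *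
        (fst G X ≫ x ((WordAlg.coords k).symm (Pi.single q 1)))) =
        ∑ s, if Quot.mk _ (τ, s) = q then
          (snd _ X ≫ b q) * mon (fun i => fst _ X ≫ coord i) s else 0 := by
      rw [MonObj.comp_mul, whiskerRight_snd_assoc, whiskerRight_fst_assoc, hι,
        WordAlg.coords_symm_apply, toHom_ofCoeff, comp_sum, Finset.mul_sum]
      refine Finset.sum_congr rfl fun s _ => ?_
      rw [comp_smul, Pi.single_apply, ← compHom_apply (fst _ X), map_mon]
      split_ifs
      · rw [one_smul]
        rfl
      · rw [zero_smul, mul_zero]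
    rw [comp_sum, Finset.sum_congr rfl fun q _ => hsum q, Finset.sum_comm]
    simp [expand]
  refine ⟨_, fun τ => (hres b τ).trans (ha τ), fun ψ hψ => ?_⟩
  obtain ⟨b', rfl⟩ := hbij.2 ψ
  congr 1
  have : b' = b := by
    ext ⟨τ, s⟩
    have := hψ τ
    simp only [hres, ← ha] at this
    exact congrFun ((expand_empty_eq_iff hR).1 this) s
  rw [this]

end Words

/-! ### Cancellation of signs, and moves between explicit words. -/

section Combinatorics

lemma sdCoeff_four {A : Type*} [CommRing A] (a b : (Fin 4 → Bool) → A) (t₀ t₁ t₂ : Bool) :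
    sdCoeff (n := 2) a b ![t₀, t₁, t₂] =
      if t₂ then a ![t₀, t₁, t₂, true] - b ![t₀, t₁, t₂, true] else b ![t₀, t₁, t₂, false] := by
  have h (c) : sn ![t₀, t₁, t₂] c = ![t₀, t₁, t₂, c] := by ext i; fin_cases i <;> rfl
  rw [sdCoeff, h, h]
  rfl

lemma sdCoeff_three {A : Type*} [CommRing A] (a b : (Fin 3 → Bool) → A) (t₀ t₁ : Bool) :
    sdCoeff (n := 1) a b ![t₀, t₁] =
      if t₁ then a ![t₀, t₁, true] - b ![t₀, t₁, true] else b ![t₀, t₁, false] := by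
  have h (c) : sn ![t₀, t₁] c = ![t₀, t₁, c] := by ext i; fin_cases i <;> rfl
  rw [sdCoeff, h, h]
  rfl

lemma sdCoeff_two {A : Type*} [CommRing A] (a b : (Fin 2 → Bool) → A) (t₀ : Bool) :
    sdCoeff (n := 0) a b ![t₀] =
      if t₀ then a ![t₀, true] - b ![t₀, true] else b ![t₀, false] := by
  have h (c) : sn ![t₀] c = ![t₀, c] := by ext i; fin_cases i <;> rfl
  rw [sdCoeff, h, h]
  rfl

/-- The alternating sum over the words occurring in the iterated bracket of four letters. -/
noncomputable def bracket {A : Type*} [AddCommGroup A] (a : Equiv.Perm (Fin 4) → A) : A :=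
  a 1 - a (word ![0, 1, 3, 2]) - (a (word ![0, 2, 3, 1]) - a (word ![0, 3, 2, 1])) -
    (a (word ![1, 2, 3, 0]) - a (word ![1, 3, 2, 0]) -
      (a (word ![2, 3, 1, 0]) - a (word ![3, 2, 1, 0])))

lemma word_eq_one : word ![0, 1, 2, 3] = 1 := by ext i; fin_cases i <;> rfl

lemma word_0132 : word ![0, 1, 3, 2] = Equiv.swap 2 3 := by ext i; fin_cases i <;> rfl

lemma word_0231 : word ![0, 2, 3, 1] = Equiv.swap 1 2 * Equiv.swap 2 3 := by
  ext i; fin_cases i <;> rfl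

lemma word_0321 : word ![0, 3, 2, 1] = Equiv.swap 1 3 := by
  ext i; fin_cases i <;> rfl

lemma word_1230 : word ![1, 2, 3, 0] = Equiv.swap 0 1 * Equiv.swap 1 2 * Equiv.swap 2 3 := by
  ext i; fin_cases i <;> rfl

lemma word_1320 : word ![1, 3, 2, 0] = Equiv.swap 0 1 * Equiv.swap 1 3 := by
  ext i; fin_cases i <;> rfl

lemma word_2310 : word ![2, 3, 1, 0] =
    Equiv.swap 0 2 * Equiv.swap 2 1 * Equiv.swap 1 3 := by
  ext i; fin_cases i <;> rfl

lemma word_3210 : word ![3, 2, 1, 0] = Equiv.swap 0 3 * Equiv.swap 1 2 := by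
  ext i; fin_cases i <;> rfl

/-- Right multiplication by `π` carries the even permutations bijectively onto those with the parity
of `π`. -/
lemma sum_even_mul {A : Type*} [AddCommMonoid A] {n : ℕ} (a : Equiv.Perm (Fin n) → A)
    (π : Equiv.Perm (Fin n)) :
    ∑ τ with Equiv.Perm.sign τ = 1, a (τ * π) =
      ∑ τ with Equiv.Perm.sign τ = Equiv.Perm.sign π, a τ := by
  refine Finset.sum_equiv (Equiv.mulRight π) (fun τ => ?_) fun τ _ => rfl
  simp

/-- Only parities matter after summation. Of the four even words in the bracket two have sign + and
two −, and likewise for the four odd ones. -/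
lemma sum_even_bracket {A : Type*} [AddCommGroup A] (a : Equiv.Perm (Fin 4) → A) :
    ∑ τ with Equiv.Perm.sign τ = 1, bracket (fun π => a (τ * π)) = 0 := by
  simp only [bracket, Finset.sum_sub_distrib, sum_even_mul]
  simp only [word_0132, word_0231, word_0321, word_1230, word_1320, word_2310, word_3210, map_mul,
    map_one, Equiv.Perm.sign_swap (show (0 : Fin 4) ≠ 1 by decide),
    Equiv.Perm.sign_swap (show (0 : Fin 4) ≠ 2 by decide),
    Equiv.Perm.sign_swap (show (0 : Fin 4) ≠ 3 by decide),
    Equiv.Perm.sign_swap (show (1 : Fin 4) ≠ 2 by decide),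
    Equiv.Perm.sign_swap (show (2 : Fin 4) ≠ 1 by decide),
    Equiv.Perm.sign_swap (show (1 : Fin 4) ≠ 3 by decide),
    Equiv.Perm.sign_swap (show (2 : Fin 4) ≠ 3 by decide)]
  simp only [mul_neg, mul_one, neg_neg]
  abel

lemma list_sum_bracket {A : Type*} [AddCommGroup A] (a : Equiv.Perm (Fin 4) → A)
    {l : List (Equiv.Perm (Fin 4))} (hl : l.Nodup)
    (hl_even : ∀ τ, τ ∈ l ↔ Equiv.Perm.sign τ = 1) :
    (l.map fun τ => bracket fun π => a (τ * π)).sum = 0 := by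
  rw [← List.sum_toFinset _ hl, ← sum_even_bracket a]
  congr 1
  ext τ
  simp [hl_even]

variable {A : Type*} {a : Equiv.Perm (Fin 4) → (Fin 4 → Bool) → A}

lemma word_step (h : ∀ (π : Equiv.Perm (Fin 4)) (i : Fin 3) s,
      ¬(s (π i.castSucc) = true ∧ s (π i.succ) = true) →
        a π s = a (π * Equiv.swap i.castSucc i.succ) s)
    (i : Fin 3) (w w' : Fin 4 → Fin 4) (hw : Function.Bijective w) (hw' : Function.Bijective w')
    (hww : ∀ j, w (Equiv.swap i.castSucc i.succ j) = w' j) {s : Fin 4 → Bool}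
    (hs : ¬(s (w i.castSucc) = true ∧ s (w i.succ) = true)) :
    a (word w hw) s = a (word w' hw') s := by
  rw [h (word w hw) i s hs]
  congr 1
  exact Equiv.ext hww

/-- Moving the letter `1` past the letters `2` and `3`. -/
lemma word_move_one (h : ∀ (π : Equiv.Perm (Fin 4)) (i : Fin 3) s,
      ¬(s (π i.castSucc) = true ∧ s (π i.succ) = true) →
        a π s = a (π * Equiv.swap i.castSucc i.succ) s)
    {s : Fin 4 → Bool} (h₂ : ¬(s 1 = true ∧ s 2 = true)) (h₃ : ¬(s 1 = true ∧ s 3 = true)) :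
    a 1 s = a (word ![0, 2, 3, 1]) s ∧ a (word ![0, 1, 3, 2]) s = a (word ![0, 3, 2, 1]) s ∧
      a (word ![1, 2, 3, 0]) s = a (word ![2, 3, 1, 0]) s ∧
      a (word ![1, 3, 2, 0]) s = a (word ![3, 2, 1, 0]) s := by
  refine ⟨?_, ?_, ?_, ?_⟩
  · rw [← word_eq_one]
    exact (word_step h 1 _ ![0, 2, 1, 3] _ (by decide) (by decide) h₂).trans
      (word_step h 2 _ _ _ _ (by decide) h₃)
  · exact (word_step h 1 _ ![0, 3, 1, 2] _ (by decide) (by decide) h₃).trans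
      (word_step h 2 _ _ _ _ (by decide) h₂)
  · exact (word_step h 0 _ ![2, 1, 3, 0] _ (by decide) (by decide) h₂).trans
      (word_step h 1 _ _ _ _ (by decide) h₃)
  · exact (word_step h 0 _ ![3, 1, 2, 0] _ (by decide) (by decide) h₃).trans
      (word_step h 1 _ _ _ _ (by decide) h₂)

/-- Moving the letter `0` from the beginning to the end. -/
lemma word_move_zero (h : ∀ (π : Equiv.Perm (Fin 4)) (i : Fin 3) s,
      ¬(s (π i.castSucc) = true ∧ s (π i.succ) = true) →
        a π s = a (π * Equiv.swap i.castSucc i.succ) s)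
    {s : Fin 4 → Bool} (h₁ : ¬(s 0 = true ∧ s 1 = true)) (h₂ : ¬(s 0 = true ∧ s 2 = true))
    (h₃ : ¬(s 0 = true ∧ s 3 = true)) :
    a 1 s = a (word ![1, 2, 3, 0]) s ∧ a (word ![0, 1, 3, 2]) s = a (word ![1, 3, 2, 0]) s ∧
      a (word ![0, 2, 3, 1]) s = a (word ![2, 3, 1, 0]) s ∧
      a (word ![0, 3, 2, 1]) s = a (word ![3, 2, 1, 0]) s := by
  refine ⟨?_, ?_, ?_, ?_⟩
  · rw [← word_eq_one]
    exact ((word_step h 0 _ ![1, 0, 2, 3] _ (by decide) (by decide) h₁).trans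
      (word_step h 1 _ ![1, 2, 0, 3] _ (by decide) (by decide) h₂)).trans
      (word_step h 2 _ _ _ _ (by decide) h₃)
  · exact ((word_step h 0 _ ![1, 0, 3, 2] _ (by decide) (by decide) h₁).trans
      (word_step h 1 _ ![1, 3, 0, 2] _ (by decide) (by decide) h₃)).trans
      (word_step h 2 _ _ _ _ (by decide) h₂)
  · exact ((word_step h 0 _ ![2, 0, 3, 1] _ (by decide) (by decide) h₂).trans
      (word_step h 1 _ ![2, 3, 0, 1] _ (by decide) (by decide) h₃)).trans
      (word_step h 2 _ _ _ _ (by decide) h₁)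
  · exact ((word_step h 0 _ ![3, 0, 2, 1] _ (by decide) (by decide) h₃).trans
      (word_step h 1 _ ![3, 2, 0, 1] _ (by decide) (by decide) h₂)).trans
      (word_step h 2 _ _ _ _ (by decide) h₁)

end Combinatorics

/-! ### Computing the Jacobi expression in the universal object. -/

section Jacobi

variable {C : Type u} [Category.{v} C] [CartesianMonoidalCategory C]

/-- The image of a mapping into `G` at stage `X` under a mapping `g` defined on `G` at stage `X`. -/
def push {G M X S : C} (g : G ⊗ X ⟶ M) (δ : S ⊗ X ⟶ G) : S ⊗ X ⟶ M :=
  lift δ (snd _ _) ≫ g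

lemma whisker_push {G M X S T : C} (g : G ⊗ X ⟶ M) (u : S ⟶ T) (ν : T ⊗ X ⟶ G) :
    u ▷ X ≫ push g ν = push g (u ▷ X ≫ ν) := by
  rw [push, push, comp_lift_assoc, whiskerRight_snd]

variable [BraidedCategory C] [HasFiniteLimits C] {k : Type w} [CommRing k] {R : C} [CommRingObj R]
  [AlgebraObj k R]

/-- The coefficients of a function on `D ^ n`. -/
noncomputable def cubeCoeff (hR : KockLawvere k R) {n : ℕ} {X : C} (φ : Cube R X R n) :
    (Fin n → Bool) → (X ⟶ R) :=
  (exists_expand hR φ).choose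

lemma expand_cubeCoeff (hR : KockLawvere k R) {n : ℕ} {X : C} (φ : Cube R X R n) :
    expand ∅ (cubeCoeff hR φ) = φ :=
  (exists_expand hR φ).choose_spec

lemma cubeCoeff_expand (hR : KockLawvere k R) {n : ℕ} {X : C} (a : (Fin n → Bool) → (X ⟶ R)) :
    cubeCoeff hR (expand ∅ a) = a :=
  (expand_empty_eq_iff hR).1 (expand_cubeCoeff hR _)

lemma cubeCoeff_permute (hR : KockLawvere k R) {n : ℕ} {X : C} (σ : Equiv.Perm (Fin n))
    (φ : Cube R X R n) :
    cubeCoeff hR (permute σ ▷ X ≫ φ) = fun s => cubeCoeff hR φ (s ∘ ⇑σ⁻¹) := by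
  conv_lhs => rw [← expand_cubeCoeff hR φ, permute_expand, cubeCoeff_expand]

lemma atZero_expand {n : ℕ} {X : C} (a : (Fin n → Bool) → (X ⟶ R)) :
    atZero (expand ∅ a) = a fun _ => false := by
  rw [atZero, expand, comp_sum, Finset.sum_eq_single fun _ => false]
  · rw [MonObj.comp_mul, lift_snd_assoc, Category.id_comp, ← compHom_apply _ (mon _ _), map_mon]
    simp [mon]
  · intro s _ hs
    obtain ⟨i, hi⟩ : ∃ i, s i = true := by
      by_contra h
      push Not at h
      exact hs (funext fun i => by simpa using h i)
    rw [MonObj.comp_mul, ← compHom_apply _ (mon _ _), map_mon, mon,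
      Finset.prod_eq_zero (Finset.mem_univ i), mul_zero]
    simp [hi, compHom_apply]
  · simp

lemma tangentZero_eq_expand {X : C} (r : X ⟶ R) :
    tangentZero R r = expand ∅ fun t : Fin 1 → Bool => if t 0 then 0 else r := by
  simp [tangentZero, expand, sum_sn, mon_sn, mon_zero, sn_default_zero, AddMonObj.comp_zero]

variable {W : Type w} [CommRing W] [Algebra k W] {G : C} {x : W →ₐ[k] (G ⟶ R)} {X M : C}
  [MonoidalClosed C]

/-- The interpolating functions in `R` glue to a mapping `ν` into the spectrum; composing it with
`g` gives an interpolation in `M`, and microlinearity makes that the only one. `G` itself need not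
be shown microlinear. -/
theorem exists_push_strongDiff (hR : KockLawvere k R) (hM : Microlinear k R M)
    (hx : IsSpec k R x) (g : G ⊗ X ⟶ M) {n : ℕ} {δ₁ δ₂ : Cube R X G (n + 2)}
    (h : ∀ f s, ¬(s (Fin.last n).castSucc = true ∧ s (Fin.last (n + 1)) = true) →
      cubeCoeff hR (δ₁ ≫ x f) s = cubeCoeff hR (δ₂ ≫ x f) s) :
    ∃ δ : Cube R X G (n + 1), strongDiff (push g δ₁) (push g δ₂) = Part.some (push g δ) ∧
      ∀ f, cubeCoeff hR (δ ≫ x f) =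
        sdCoeff (cubeCoeff hR (δ₁ ≫ x f)) (cubeCoeff hR (δ₂ ≫ x f)) := by
  choose μ h₁ h₂ h₃ using fun f => exists_strongDiff (h f)
  simp only [expand_cubeCoeff] at h₁ h₂
  obtain ⟨ν, rfl, rfl⟩ := hx.glue_pair (fun ν ν' => strongDiff_ext hR) δ₁ δ₂
    fun f => ⟨μ f, h₁ f, h₂ f⟩
  refine ⟨e n ▷ X ≫ ν, ?_, fun f => ?_⟩
  · rw [← whisker_push, ← whisker_push, ← whisker_push]
    exact hM.strongDiff_eq_some hR rfl rfl
  · have : ν ≫ x f = μ f := strongDiff_ext hR (by rw [h₁, Category.assoc])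
      (by rw [h₂, Category.assoc])
    rw [Category.assoc (e n ▷ X), this, h₃, cubeCoeff_expand]

theorem exists_push_tangentAdd (hR : KockLawvere k R) (hM : Microlinear k R M)
    (hx : IsSpec k R x) (g : G ⊗ X ⟶ M) {δ₁ δ₂ : Cube R X G 1}
    (h : ∀ f, cubeCoeff hR (δ₁ ≫ x f) ![false] = cubeCoeff hR (δ₂ ≫ x f) ![false]) :
    ∃ δ : Cube R X G 1, tangentAdd (push g δ₁) (push g δ₂) = Part.some (push g δ) ∧
      ∀ f, cubeCoeff hR (δ ≫ x f) =
        taCoeff (cubeCoeff hR (δ₁ ≫ x f)) (cubeCoeff hR (δ₂ ≫ x f)) := by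
  choose μ h₁ h₂ h₃ using fun f => exists_tangentAdd (h f)
  simp only [expand_cubeCoeff] at h₁ h₂
  obtain ⟨ν, rfl, rfl⟩ := hx.glue_pair (fun ν ν' => tangentAdd_ext hR) δ₁ δ₂
    fun f => ⟨μ f, h₁ f, h₂ f⟩
  refine ⟨diag ▷ X ≫ ν, ?_, fun f => ?_⟩
  · rw [← whisker_push, ← whisker_push, ← whisker_push]
    exact hM.tangentAdd_eq_some hR rfl rfl
  · have : ν ≫ x f = μ f := tangentAdd_ext hR (by rw [h₁, Category.assoc])
      (by rw [h₂, Category.assoc])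
    rw [Category.assoc (diag ▷ X), this, h₃, cubeCoeff_expand]

/-- The iterated strong difference of a compatible family of cubes in `Spec_R W`. -/
theorem exists_push_bracket (hR : KockLawvere k R) (hM : Microlinear k R M)
    (hx : IsSpec k R x) (g : G ⊗ X ⟶ M) (δ : Equiv.Perm (Fin 4) → Cube R X G 4)
    (hδ : ∀ f (π : Equiv.Perm (Fin 4)) (i : Fin 3) s,
      ¬(s (π i.castSucc) = true ∧ s (π i.succ) = true) → cubeCoeff hR (δ π ≫ x f) s =
        cubeCoeff hR (δ (π * Equiv.swap i.castSucc i.succ) ≫ x f) s) :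
    ∃ t : Cube R X G 1,
      strongDiffPart
        (strongDiffPart
          (strongDiff (push g (δ 1)) (push g (δ (word ![0, 1, 3, 2]))))
          (strongDiff (push g (δ (word ![0, 2, 3, 1]))) (push g (δ (word ![0, 3, 2, 1])))))
        (strongDiffPart
          (strongDiff (push g (δ (word ![1, 2, 3, 0]))) (push g (δ (word ![1, 3, 2, 0]))))
          (strongDiff (push g (δ (word ![2, 3, 1, 0]))) (push g (δ (word ![3, 2, 1, 0]))))) =
        Part.some (push g t) ∧
      ∀ f, cubeCoeff hR (t ≫ x f) = fun u => if u 0 then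
        bracket (fun π => cubeCoeff hR (δ π ≫ x f) fun _ => true) else
          cubeCoeff hR (δ 1 ≫ x f) fun _ => false := by
  have h4 (s : Fin 4 → Bool) : s = ![s 0, s 1, s 2, s 3] := by ext i; fin_cases i <;> rfl
  have h3 (s : Fin 3 → Bool) : s = ![s 0, s 1, s 2] := by ext i; fin_cases i <;> rfl
  have h2 (s : Fin 2 → Bool) : s = ![s 0, s 1] := by ext i; fin_cases i <;> rfl
  have h1 (s : Fin 1 → Bool) : s = ![s 0] := by ext i; fin_cases i; rfl
  obtain ⟨A, hA, hA'⟩ := exists_push_strongDiff hR hM hx g (n := 2)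
    (δ₁ := δ 1) (δ₂ := δ (word ![0, 1, 3, 2])) fun f s hs => by
      rw [← word_eq_one]
      exact word_step (hδ f) 2 _ _ _ _ (by decide) hs
  obtain ⟨B, hB, hB'⟩ := exists_push_strongDiff hR hM hx g (n := 2)
    (δ₁ := δ (word ![0, 2, 3, 1])) (δ₂ := δ (word ![0, 3, 2, 1])) fun f s hs =>
      word_step (hδ f) 1 _ _ _ _ (by decide) hs
  obtain ⟨A', hA₁, hA₁'⟩ := exists_push_strongDiff hR hM hx g (n := 2)
    (δ₁ := δ (word ![1, 2, 3, 0])) (δ₂ := δ (word ![1, 3, 2, 0])) fun f s hs =>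
      word_step (hδ f) 1 _ _ _ _ (by decide) hs
  obtain ⟨B', hB₁, hB₁'⟩ := exists_push_strongDiff hR hM hx g (n := 2)
    (δ₁ := δ (word ![2, 3, 1, 0])) (δ₂ := δ (word ![3, 2, 1, 0])) fun f s hs =>
      word_step (hδ f) 0 _ _ _ _ (by decide) hs
  obtain ⟨E, hE, hE'⟩ := exists_push_strongDiff hR hM hx g (n := 1) (δ₁ := A) (δ₂ := B)
    fun f s hs => by
      rw [hA', hB', h3 s, sdCoeff_four, sdCoeff_four]
      change ¬(s 1 = true ∧ s 2 = true) at hs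
      -- If letter 2 is absent, so is letter 3 and lower coefficients are compared; otherwise letter
      -- 1 is absent. Either way letter 1 moves freely past 2 and 3.
      cases h : s 2
      · exact (word_move_one (hδ f) (by simp) (by simp)).2.1
      · have h' : s 1 = false := by simpa [h] using hs
        have := word_move_one (hδ f) (s := ![s 0, s 1, true, true]) (by simp [h']) (by simp [h'])
        simp only [if_true, this]
  obtain ⟨E', hE₁, hE₁'⟩ := exists_push_strongDiff hR hM hx g (n := 1) (δ₁ := A') (δ₂ := B')
    fun f s hs => by
      rw [hA₁', hB₁', h3 s, sdCoeff_four, sdCoeff_four]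
      change ¬(s 1 = true ∧ s 2 = true) at hs
      cases h : s 2
      · exact (word_move_one (hδ f) (by simp) (by simp)).2.2.2
      · have h' : s 1 = false := by simpa [h] using hs
        have := word_move_one (hδ f) (s := ![s 0, s 1, true, true]) (by simp [h']) (by simp [h'])
        simp only [if_true, this]
  obtain ⟨t, ht, ht'⟩ := exists_push_strongDiff hR hM hx g (n := 0) (δ₁ := E) (δ₂ := E')
    fun f s hs => by
      rw [hE', hE₁', h2 s, sdCoeff_three, sdCoeff_three, hA', hB', hA₁', hB₁']
      simp only [sdCoeff_four]
      change ¬(s 0 = true ∧ s 1 = true) at hs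
      -- Either only letter 0 can occur in the support, or letter 0 does not occur; in both cases it
      -- moves freely to the end.
      cases h : s 1
      · exact (word_move_zero (hδ f) (by simp) (by simp) (by simp)).2.2.2
      · have h' : s 0 = false := by simpa [h] using hs
        have := word_move_zero (hδ f) (s := ![s 0, true, true, true]) (by simp [h']) (by simp [h'])
          (by simp [h'])
        simp only [if_true, this]
  refine ⟨t, ?_, fun f => funext fun u => ?_⟩
  · rw [hA, hB, hA₁, hB₁]
    simp only [strongDiffPart, Part.bind_some, hE, hE₁, ht]
  · have hT : (![true, true, true, true] : Fin 4 → Bool) = fun _ => true := by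
      ext i; fin_cases i <;> rfl
    have hF : (![false, false, false, false] : Fin 4 → Bool) = fun _ => false := by
      ext i; fin_cases i <;> rfl
    rw [ht', h1 u, sdCoeff_two, hE', hE₁', sdCoeff_three, sdCoeff_three, sdCoeff_three, hA', hB',
      hA₁', hB₁']
    simp only [sdCoeff_four]
    cases u 0
    · simp only [hF, Matrix.cons_val_zero, Bool.false_eq_true, if_false]
      -- The constant coefficient produced is that of the last word `3210`; constant coefficients
      -- are the same for all words.
      exact eq_one_of_swap_invariant (m := 3)
        (fun π => cubeCoeff hR (δ π ≫ x f) fun _ => false) (fun π i => hδ f π i _ (by simp)) _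
    · simp only [hT, Matrix.cons_val_zero, if_true]
      rfl

theorem exists_push_jacobiTerm (hR : KockLawvere k R) (hM : Microlinear k R M)
    (hx : IsSpec k R x) (g : G ⊗ X ⟶ M) (δ : Equiv.Perm (Fin 4) → Cube R X G 4)
    (hδ : ∀ f (π : Equiv.Perm (Fin 4)) (i : Fin 3) s,
      ¬(s (π i.castSucc) = true ∧ s (π i.succ) = true) → cubeCoeff hR (δ π ≫ x f) s =
        cubeCoeff hR (δ (π * Equiv.swap i.castSucc i.succ) ≫ x f) s)
    (τ : Equiv.Perm (Fin 4)) :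
    ∃ t : Cube R X G 1, jacobiTerm (fun π => push g (δ π)) τ = Part.some (push g t) ∧
      ∀ f, cubeCoeff hR (t ≫ x f) = fun u => if u 0 then
        bracket (fun π => cubeCoeff hR (δ (τ * π) ≫ x f) fun _ => true) else
          cubeCoeff hR (δ 1 ≫ x f) fun _ => false := by
  have hc (f) (π) : cubeCoeff hR ((permute τ ▷ X ≫ δ π) ≫ x f) =
      fun s => cubeCoeff hR (δ π ≫ x f) (s ∘ ⇑τ⁻¹) := by
    rw [Category.assoc, cubeCoeff_permute]
  -- Relabelling the variables by `τ` cancels the left factor `τ` in the compatibility conditions,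
  -- so the case of the word `1234` applies.
  obtain ⟨t, ht, ht'⟩ := exists_push_bracket hR hM hx g (fun π => permute τ ▷ X ≫ δ (τ * π))
    (fun f π i s hs => by
      rw [hc, hc, ← mul_assoc]
      exact hδ f (τ * π) i _ (by simpa using hs))
  refine ⟨t, ?_, fun f => ?_⟩
  · rw [← ht]
    simp only [jacobiTerm, strongDiffPerm, whisker_push, mul_one]
  · rw [ht']
    ext1 u
    simp only [hc, mul_one]
    have : cubeCoeff hR (δ τ ≫ x f) (fun _ => false) = cubeCoeff hR (δ 1 ≫ x f) fun _ => false :=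
      eq_one_of_swap_invariant (m := 3)
        (fun π => cubeCoeff hR (δ π ≫ x f) fun _ => false) (fun π i => hδ f π i _ (by simp)) _
    rw [← this]
    rfl

/-- All partial sums have the same constant coefficient, so each addition is defined and linear
coefficients add. Arbitrary lists are allowed so that the induction runs; evenness enters only at
the end. -/
theorem exists_push_tangentSum (hR : KockLawvere k R) (hM : Microlinear k R M)
    (hx : IsSpec k R x) (g : G ⊗ X ⟶ M) (δ : Equiv.Perm (Fin 4) → Cube R X G 4)
    (hδ : ∀ f (π : Equiv.Perm (Fin 4)) (i : Fin 3) s,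
      ¬(s (π i.castSucc) = true ∧ s (π i.succ) = true) → cubeCoeff hR (δ π ≫ x f) s =
        cubeCoeff hR (δ (π * Equiv.swap i.castSucc i.succ) ≫ x f) s)
    (l : List (Equiv.Perm (Fin 4))) :
    ∃ t : Cube R X G 1, tangentSum (atZero (push g (δ 1)))
        (l.map (jacobiTerm fun π => push g (δ π))) = Part.some (push g t) ∧
      ∀ f, cubeCoeff hR (t ≫ x f) = fun u => if u 0 then
        (l.map fun τ => bracket fun π => cubeCoeff hR (δ (τ * π) ≫ x f) fun _ => true).sum else
          cubeCoeff hR (δ 1 ≫ x f) fun _ => false := by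
  induction l with
  | nil =>
    refine ⟨tangentZero R (atZero (δ 1)), ?_, fun f => ?_⟩
    · simp [tangentSum, tangentZero, push, atZero, comp_lift_assoc]
    · have h₁ : tangentZero R (atZero (δ 1)) ≫ x f = tangentZero R (atZero (δ 1) ≫ x f) :=
        Category.assoc _ _ _
      have h₂ : atZero (δ 1) ≫ x f = atZero (δ 1 ≫ x f) := Category.assoc _ _ _
      rw [h₁, h₂, tangentZero_eq_expand, cubeCoeff_expand]
      conv_lhs => rw [← expand_cubeCoeff hR (δ 1 ≫ x f), atZero_expand]
      rfl
  | cons τ l ih =>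
    obtain ⟨t, ht, ht'⟩ := ih
    obtain ⟨t₁, ht₁, ht₁'⟩ := exists_push_jacobiTerm hR hM hx g δ hδ τ
    obtain ⟨t₂, ht₂, ht₂'⟩ := exists_push_tangentAdd hR hM hx g (δ₁ := t₁) (δ₂ := t)
      (fun f => by rw [ht', ht₁']; rfl)
    refine ⟨t₂, ?_, fun f => ?_⟩
    · rw [tangentSum] at ht ⊢
      rw [List.map_cons, List.foldr_cons, ht, ht₁]
      simp only [Part.bind_some, ht₂]
    · rw [ht₂', ht', ht₁']
      ext1 u
      simp only [taCoeff, List.map_cons, List.sum_cons]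
      cases u 0 <;> rfl

end Jacobi

end SDG

/-! ### The Jacobi identity, by reduction to the universal family. -/

theorem theorem3p2 {C : Type u} [Category.{v} C] [CartesianMonoidalCategory C] [BraidedCategory C]
    [MonoidalClosed C] [HasFiniteLimits C]
    (k : Type w) [CommRing k] (R : C) [CommRingObj R] [SDG.AlgebraObj k R]
    (hR : SDG.KockLawvere k R) (M : C) (hM : SDG.Microlinear k R M) (X : C)
    (γ : Equiv.Perm (Fin 4) → SDG.Cube R X M 4)
    (hγ : ∀ (τ : Equiv.Perm (Fin 4)) (i : Fin 3),
      SDG.AgreeOn {(τ i.castSucc, τ i.succ)} (γ τ) (γ (τ * Equiv.swap i.castSucc i.succ)))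
    (l : List (Equiv.Perm (Fin 4))) (hl : l.Nodup)
    (hl_even : ∀ τ, τ ∈ l ↔ Equiv.Perm.sign τ = 1) :
    SDG.tangentSum (SDG.atZero (γ 1)) (l.map (SDG.jacobiTerm γ)) =
      Part.some (SDG.tangentZero R (SDG.atZero (γ 1))) := by
  obtain ⟨G, x, hx⟩ := SDG.exists_isSpec (k := k) (R := R) (W := SDG.WordAlg k 3)
    (Module.Basis.ofEquivFun (SDG.WordAlg.coords k))
  choose ι hι using fun τ : Equiv.Perm (Fin 4) =>
    (hx _ ((SDG.FunAlg.toHom k (R := R)).comp (SDG.WordAlg.component k (m := 3) τ))).exists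
  have hι' (τ f) : ι τ ≫ x f = SDG.FunAlg.toHom k (f.1 τ) := DFunLike.congr_fun (hι τ) f
  obtain ⟨g, hg⟩ := SDG.word_glue hR hx hι' hM γ hγ
  let δ (τ : Equiv.Perm (Fin 4)) : SDG.Cube R X G 4 := fst _ _ ≫ ι τ
  have hγδ : γ = fun τ => SDG.push g (δ τ) := by
    ext1 τ
    rw [← hg τ, SDG.push]
    congr 1
    ext <;> simp [δ]
  have hδ (f) (π : Equiv.Perm (Fin 4)) (i : Fin 3) (s)
      (hs : ¬(s (π i.castSucc) = true ∧ s (π i.succ) = true)) : SDG.cubeCoeff hR (δ π ≫ x f) s =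
        SDG.cubeCoeff hR (δ (π * Equiv.swap i.castSucc i.succ) ≫ x f) s := by
    refine (SDG.agreeOn_expand_iff hR (SDG.ne_of_perm (m := 3) π i)).1 ?_ s hs
    rw [SDG.expand_cubeCoeff, SDG.expand_cubeCoeff, SDG.AgreeOn]
    simp only [δ, Category.assoc, whiskerRight_fst_assoc, hι', SDG.incl_toHom]
    exact congrArg _ (congrArg _ (f.2 π i))
  rw [hγδ]
  obtain ⟨t, ht, ht'⟩ := SDG.exists_push_tangentSum hR hM hx g δ hδ l
  -- The empty sum is the zero tangent vector. It is enough that both sums come from equal mappings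
  -- into `G`, which the functions `x f` detect.
  obtain ⟨t₀, ht₀, ht₀'⟩ := SDG.exists_push_tangentSum hR hM hx g δ hδ []
  have htt : t = t₀ := hx.hom_ext fun f => by
    rw [← SDG.expand_cubeCoeff hR (t ≫ x f), ← SDG.expand_cubeCoeff hR (t₀ ≫ x f), ht', ht₀',
      SDG.list_sum_bracket (fun π => SDG.cubeCoeff hR (δ π ≫ x f) fun _ => true) hl hl_even]
    rfl
  rw [ht, htt, ← ht₀]
  rfl
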